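/- Let $N\ge 1$, $T>0$, $0<\rho\le 1$. Let $A(D)=\sum_{|\alpha|=m}a_\alpha D^\alpha$, $D_j=-i\,\partial/\partial x_j$, be a homogeneous differential operator of order $m$ with constant (complex) coefficients that is elliptic ($A(\xi)=\sum_{|\alpha|=m}a_\alpha\xi^\alpha\neq0$ for $0\ne\xi\in\mathbb R^N$), symmetric ($(A(D)g,h)=(g,A(D)h)$) and positive ($(A(D)g,g)\ge 0$) on smooth functions that are $2\pi$-periodic in each variable, where $(\cdot,\cdot)$ is the scalar product of $L_2(\mathbb T^N)$, $\mathbb T^N=(-\pi,\pi]^N$. For $0<\rho<1$ let $$D_t^\rho g(t)=\frac1{\Gamma(1-\rho)}\int_0^t\frac{g'(\tau)\,d\tau}{(t-\tau)^\rho}$$ be the Caputo derivative, which is said to exist at $t$ if $g$ is absolutely continuous on $[0,t]$ and the integral converges (as a Lebesgue integral); for $\rho=1$ let $D_t^\rho=d/dt$ (one-sided at $t=T$). Let $\varphi,\Psi:\mathbb R^N\to\mathbb C$ be continuous and $2\pi$-periodic in each variable. A classical solution of the inverse problem is a pair $\{u(x,t),f(x)\}$ of complex-valued functions, $2\pi$-periodic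 in each $x_j$, such that $f\in C(\mathbb T^N)$, $u\in C(\mathbb T^N\times[0,T])$, $u(\cdot,t)\in C^m(\mathbb R^N)$ for $0<t\le T$, $D_t^\rho u$ exists on $\mathbb T^N\times(0,T]$, $D_t^\rho u,\,A(D)u\in C(\mathbb T^N\times(0,T])$, and $$D_t^\rho u(x,t)+A(D)u(x,t)=f(x)\quad(x\in\mathbb T^N,\ 0<t\le T),\qquad u(x,0)=\varphi(x),\qquad u(x,T)=\Psi(x)\quad(x\in\mathbb T^N).$$ Then there is at most one classical solution: if $\{u_1,f_1\}$ and $\{u_2,f_2\}$ are classical solutions with the same $\varphi$ and $\Psi$, then $u_1=u_2$ on $\mathbb T^N\times[0,T]$ and $f_1=f_2$ on $\mathbb T^N$. -/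

import Mathlib

open MeasureTheory Set
open scoped ContDiff

noncomputable section

namespace Subdiffusion

/-- `g` is `2π`-periodic in each of the variables `x₁, …, x_N`; such functions are the functions
on the torus `𝕋^N`. -/
def TorusPeriodic {N : ℕ} (g : (Fin N → ℝ) → ℂ) : Prop :=
  ∀ j : Fin N, Function.Periodic g (Pi.single j (2 * Real.pi))

/-- The fundamental cell `(-π, π]^N`. -/
def cell (N : ℕ) : Set (Fin N → ℝ) :=
  Set.univ.pi fun _ => Set.Ioc (-Real.pi) Real.pi

/-- The scalar product of `L₂(𝕋^N)`. -/
def torusInner {N : ℕ} (g h : (Fin N → ℝ) → ℂ) : ℂ :=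
  ∫ x in cell N, g x * (starRingEnd ℂ) (h x)

/-- `D_j = -i ∂/∂x_j`, so that `D_j e^{inx} = n_j e^{inx}`. -/
def dOp {N : ℕ} (j : Fin N) (g : (Fin N → ℝ) → ℂ) : (Fin N → ℝ) → ℂ :=
  fun x => -Complex.I * lineDeriv ℝ g x (Pi.single j 1)

/-- `D^α = D_1^{α_1} ⋯ D_N^{α_N}`. -/
def dPow {N : ℕ} (α : Fin N → ℕ) (g : (Fin N → ℝ) → ℂ) : (Fin N → ℝ) → ℂ :=
  (List.finRange N).foldr (fun j h => (dOp j)^[α j] h) g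

/-- The multi-indices `α` with `|α| = m`. -/
def multiIndices (N m : ℕ) : Finset (Fin N → ℕ) :=
  Finset.piAntidiag Finset.univ m

/-- The homogeneous operator `A(D) = ∑_{|α| = m} a_α D^α` with constant coefficients. -/
def diffOp {N : ℕ} (m : ℕ) (a : (Fin N → ℕ) → ℂ) (g : (Fin N → ℝ) → ℂ) : (Fin N → ℝ) → ℂ :=
  fun x => ∑ α ∈ multiIndices N m, a α * dPow α g x

/-- The symbol `A(ξ) = ∑_{|α| = m} a_α ξ^α`. -/
def symbol {N : ℕ} (m : ℕ) (a : (Fin N → ℕ) → ℂ) (ξ : Fin N → ℝ) : ℂ :=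
  ∑ α ∈ multiIndices N m, a α * ∏ j, (ξ j : ℂ) ^ α j

/-- `A(D)` is elliptic: its symbol has no real zeros other than `0`. -/
def IsElliptic {N : ℕ} (m : ℕ) (a : (Fin N → ℕ) → ℂ) : Prop :=
  ∀ ξ : Fin N → ℝ, ξ ≠ 0 → symbol m a ξ ≠ 0

/-- `A(D)` is symmetric: `(A g, h) = (g, A h)` for smooth periodic `g`, `h`. -/
def IsSymmetricOp {N : ℕ} (m : ℕ) (a : (Fin N → ℕ) → ℂ) : Prop :=
  ∀ g h : (Fin N → ℝ) → ℂ, ContDiff ℝ ∞ g → TorusPeriodic g → ContDiff ℝ ∞ h → TorusPeriodic h →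
    torusInner (diffOp m a g) h = torusInner g (diffOp m a h)

/-- `A(D)` is positive: `(A g, g) ≥ 0` for smooth periodic `g`. (Equality occurs for constant `g`
as soon as `m ≥ 1`.) -/
def IsPositiveOp {N : ℕ} (m : ℕ) (a : (Fin N → ℕ) → ℂ) : Prop :=
  ∀ g : (Fin N → ℝ) → ℂ, ContDiff ℝ ∞ g → TorusPeriodic g →
    0 ≤ (torusInner (diffOp m a g) g).re

/-- The Caputo derivative of order `ρ ∈ (0, 1]` at the time `t ∈ (0, T]` of a function given on
`[0, T]`. For `ρ = 1` it is the ordinary derivative (one-sided at `T`). -/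
def caputoDeriv (ρ T : ℝ) (g : ℝ → ℂ) (t : ℝ) : ℂ :=
  if ρ = 1 then derivWithin g (Set.Icc 0 T) t
  else ((1 / Real.Gamma (1 - ρ) : ℝ) : ℂ) * ∫ τ in (0 : ℝ)..t, ((t - τ) ^ (-ρ) : ℝ) • deriv g τ

/-- The Caputo derivative of order `ρ` of `g` exists at `t`: for `ρ = 1`, `g` is differentiable
at `t`; for `ρ < 1`, `g` is absolutely continuous on `[0, t]` (so that `g'` is meaningful under the
integral sign) and the defining integral converges. A function that is continuous on `[0, t]`,
differentiable at every point of `(0, t)` and has a convergent defining integral is absolutely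
continuous on `[0, t]`, so it satisfies this condition. -/
def CaputoDifferentiableAt (ρ T : ℝ) (g : ℝ → ℂ) (t : ℝ) : Prop :=
  if ρ = 1 then DifferentiableWithinAt ℝ g (Set.Icc 0 T) t
  else AbsolutelyContinuousOnInterval g 0 t ∧
    IntervalIntegrable (fun τ => ((t - τ) ^ (-ρ) : ℝ) • deriv g τ) volume 0 t

/-- `{u, f}` is a classical solution of the inverse problem
`D_t^ρ u + A(D) u = f` on `𝕋^N × (0, T]`, `u(x, 0) = φ(x)`, `u(x, T) = Ψ(x)`. Only the values of
`u` at times in `[0, T]` matter. -/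
structure IsClassicalSolution {N : ℕ} (m : ℕ) (a : (Fin N → ℕ) → ℂ) (ρ T : ℝ)
    (φ Ψ : (Fin N → ℝ) → ℂ) (u : (Fin N → ℝ) → ℝ → ℂ) (f : (Fin N → ℝ) → ℂ) : Prop where
  f_continuous : Continuous f
  f_periodic : TorusPeriodic f
  u_continuous : ContinuousOn (fun p : (Fin N → ℝ) × ℝ => u p.1 p.2) (Set.univ ×ˢ Set.Icc 0 T)
  u_periodic : ∀ t ∈ Set.Icc 0 T, TorusPeriodic fun x => u x t
  caputo_exists : ∀ x, ∀ t ∈ Set.Ioc 0 T, CaputoDifferentiableAt ρ T (u x) t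
  caputo_continuous :
    ContinuousOn (fun p : (Fin N → ℝ) × ℝ => caputoDeriv ρ T (u p.1) p.2)
      (Set.univ ×ˢ Set.Ioc 0 T)
  u_contDiff : ∀ t ∈ Set.Ioc 0 T, ContDiff ℝ m fun x => u x t
  diffOp_continuous :
    ContinuousOn (fun p : (Fin N → ℝ) × ℝ => diffOp m a (fun y => u y p.2) p.1)
      (Set.univ ×ˢ Set.Ioc 0 T)
  equation : ∀ x, ∀ t ∈ Set.Ioc 0 T,
    caputoDeriv ρ T (u x) t + diffOp m a (fun y => u y t) x = f x
  initial : ∀ x, u x 0 = φ x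
  final : ∀ x, u x T = Ψ x

end Subdiffusion

end

/-! Fourier coefficients in `x` reduce the problem to ordinary fractional equations in `t`. By
symmetry and positivity the symbol takes a real value `lam ≥ 0` at each integer point `n`. The
`n`-th coefficient `y` of the difference of two solutions vanishes at `0` and `T` and formally
satisfies `D^ρ y + lam y = c`, where `c` is the coefficient of the difference of the sources. It
must be shown that `c = 0` and `y = 0`; completeness of the characters (`eq_zero_of_fcoef_eq_zero`)
then gives the theorem.

The absolute continuity of `u x` is not uniform in `x`, so it does not pass directly to the
coefficients. The equation is therefore used in the integrated form `I^{1-ρ}(y - y(0)) = ∫ (c - lam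
y)`. For each `x` the Caputo derivative is integrated over `[ε, t]`, Fubini moves the coefficient
inside, and `ε → 0` (`caputoPrimitive_timeCoef`).

The relaxation problem is settled by an extremum principle (`IntegratedRelaxation.le_of_isMin`): at
a nonpositive minimum `t₀ > 0` one has `c - lam y(t₀) ≤ 0`. Hence `c ≤ 0`, and `-y` gives `c ≥ 0`;
for `lam > 0` the same inequalities give `y = 0`, and for `lam = 0` the integrated equation does.
The principle needs a Lipschitz bound for `y` at `t₀`, whereas `y` is only known to be continuous.
Applying `I^ρ` repeatedly writes `y` as a finite sum of powers of `t` plus a multiple of `I^{(n+1)ρ}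
y`, which is differentiable for large `n`. -/

noncomputable section

namespace Subdiffusion

open Filter Topology

/-! ### Riemann–Liouville integrals and their semigroup law. -/

/-- The Riemann–Liouville integral of order `a` with base point `0`. -/
def fracInt {E : Type*} [NormedAddCommGroup E] [NormedSpace ℝ E] (a : ℝ) (f : ℝ → E) (t : ℝ) : E :=
  (Real.Gamma a)⁻¹ • ∫ s in (0 : ℝ)..t, ((t - s) ^ (a - 1) : ℝ) • f s

lemma integral_beta_kernel {a b τ t : ℝ} (ha : 0 < a) (hb : 0 < b) (h : τ < t) :
    ∫ s in τ..t, (t - s) ^ (a - 1) * (s - τ) ^ (b - 1)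
      = ProbabilityTheory.beta a b * (t - τ) ^ (a + b - 1) := by
  have h0 : 0 < t - τ := sub_pos.2 h
  have e1 : ∫ s in τ..t, (t - s) ^ (a - 1) * (s - τ) ^ (b - 1)
      = ∫ x in (0 : ℝ)..(t - τ), x ^ (b - 1) * ((t - τ) - x) ^ (a - 1) := by
    have := intervalIntegral.integral_comp_sub_right (a := τ) (b := t)
      (fun x : ℝ => x ^ (b - 1) * ((t - τ) - x) ^ (a - 1)) τ
    rw [sub_self] at this
    rw [← this]
    congr 1; ext s
    rw [mul_comm, show t - τ - (s - τ) = t - s by ring]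
  rw [e1]
  have e2 := Complex.betaIntegral_scaled (b : ℂ) (a : ℂ) h0
  have e3 : ∫ x in (0 : ℝ)..(t - τ), (x : ℂ) ^ ((b : ℂ) - 1) * (((t - τ : ℝ) : ℂ) - x) ^ ((a : ℂ) - 1)
      = ((∫ x in (0 : ℝ)..(t - τ), x ^ (b - 1) * ((t - τ) - x) ^ (a - 1) : ℝ) : ℂ) := by
    rw [← intervalIntegral.integral_ofReal]
    apply intervalIntegral.integral_congr
    intro x hx
    rw [uIcc_of_le h0.le] at hx
    simp only
    push_cast
    rw [Complex.ofReal_cpow hx.1, Complex.ofReal_cpow (by linarith [hx.2])]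
    push_cast
    rfl
  rw [e3] at e2
  have e4 : ((b : ℂ) + a - 1) = ((b + a - 1 : ℝ) : ℂ) := by push_cast; rfl
  rw [e4, ← Complex.ofReal_cpow h0.le] at e2
  have e5 := congrArg Complex.re e2
  rw [Complex.ofReal_re, Complex.re_ofReal_mul, ← ProbabilityTheory.beta_eq_betaIntegralReal b a hb ha]
    at e5
  rw [e5, mul_comm, add_comm b a]
  unfold ProbabilityTheory.beta
  rw [mul_comm (Real.Gamma b), add_comm b a]

lemma intervalIntegrable_beta_kernel {a b τ t : ℝ} (ha : 0 < a) (hb : 0 < b) (h : τ < t) :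
    IntervalIntegrable (fun s => (t - s) ^ (a - 1) * (s - τ) ^ (b - 1)) volume τ t := by
  -- The integral of a non-integrable function is `0` by convention, so a nonzero value proves
  -- integrability.
  apply intervalIntegral.intervalIntegrable_of_integral_ne_zero
  rw [integral_beta_kernel ha hb h]
  have := ProbabilityTheory.beta_pos ha hb
  have := Real.rpow_pos_of_pos (sub_pos.2 h) (a + b - 1)
  positivity

lemma intervalIntegrable_rpow_sub {a : ℝ} (ha : 0 < a) (t : ℝ) :
    IntervalIntegrable (fun s => (t - s) ^ (a - 1)) volume 0 t := by
  have := (intervalIntegral.intervalIntegrable_rpow' (a := 0) (b := t) (r := a - 1) (by linarith)).comp_sub_left t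
  simpa using this.symm

section FractionalIntegral

variable {E : Type*} [NormedAddCommGroup E] [NormedSpace ℝ E]

/-- The integrand of the double integral `fracInt a (fracInt b f) t`. -/
def abelKernel (a b t : ℝ) (f : ℝ → E) (s τ : ℝ) : E :=
  if τ < s then ((t - s) ^ (a - 1) * (s - τ) ^ (b - 1)) • f τ else 0

lemma abelKernel_integral_snd (a b : ℝ) {t s : ℝ} (f : ℝ → E) (hs : s ∈ Ioc 0 t) :
    ∫ τ in Ioc 0 t, abelKernel a b t f s τ
      = (t - s) ^ (a - 1) • ∫ τ in (0 : ℝ)..s, ((s - τ) ^ (b - 1) : ℝ) • f τ := by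
  rw [intervalIntegral.integral_of_le hs.1.le, ← integral_smul, integral_Ioc_eq_integral_Ioo (y := s)]
  have : ∀ τ, abelKernel a b t f s τ = (Iio s).indicator
      (fun τ => (t - s) ^ (a - 1) • (s - τ) ^ (b - 1) • f τ) τ := by
    intro τ
    simp [abelKernel, indicator_apply, smul_smul]
  simp_rw [this]
  rw [setIntegral_indicator measurableSet_Iio]
  congr 2
  ext x; simp only [mem_inter_iff, mem_Ioc, mem_Iio, mem_Ioo]
  constructor
  · rintro ⟨⟨h1, h2⟩, h3⟩; exact ⟨h1, h3⟩
  · rintro ⟨h1, h3⟩; exact ⟨⟨h1, h3.le.trans hs.2⟩, h3⟩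

lemma Ioc_inter_Ioi_of_pos {τ t : ℝ} (hτ : 0 < τ) : Ioc 0 t ∩ Ioi τ = Ioc τ t := by
  ext x; simp only [mem_inter_iff, mem_Ioc, mem_Ioi]
  constructor
  · rintro ⟨⟨h1, h2⟩, h3⟩; exact ⟨h3, h2⟩
  · rintro ⟨h1, h3⟩; exact ⟨⟨hτ.trans h1, h3⟩, h1⟩

lemma abelKernel_integral_fst [CompleteSpace E] {a b : ℝ} (ha : 0 < a) (hb : 0 < b) {t τ : ℝ} (f : ℝ → E)
    (hτ : τ ∈ Ioo 0 t) :
    Integrable (fun s => abelKernel a b t f s τ) (volume.restrict (Ioc 0 t)) ∧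
    ∫ s in Ioc 0 t, abelKernel a b t f s τ
      = ProbabilityTheory.beta a b • (t - τ) ^ (a + b - 1) • f τ := by
  have key : ∀ s, abelKernel a b t f s τ = (Ioi τ).indicator
      (fun s => ((t - s) ^ (a - 1) * (s - τ) ^ (b - 1)) • f τ) s := by
    intro s
    simp [abelKernel, indicator_apply]
  simp_rw [key]
  constructor
  · rw [integrable_indicator_iff measurableSet_Ioi, IntegrableOn, Measure.restrict_restrict measurableSet_Ioi,
      inter_comm, Ioc_inter_Ioi_of_pos hτ.1]
    exact ((intervalIntegrable_iff_integrableOn_Ioc_of_le hτ.2.le).1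
      (intervalIntegrable_beta_kernel ha hb hτ.2)).smul_const _
  · rw [setIntegral_indicator measurableSet_Ioi, Ioc_inter_Ioi_of_pos hτ.1,
      ← intervalIntegral.integral_of_le hτ.2.le, intervalIntegral.integral_smul_const,
      integral_beta_kernel ha hb hτ.2, smul_smul]

lemma norm_abelKernel (a b : ℝ) {t s : ℝ} (hs : s ≤ t) (f : ℝ → E) (τ : ℝ) :
    ‖abelKernel a b t f s τ‖ = abelKernel a b t (fun τ => ‖f τ‖) s τ := by
  unfold abelKernel
  split_ifs with h
  · rw [norm_smul, smul_eq_mul, Real.norm_of_nonneg]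
    have h1 : 0 ≤ t - s := sub_nonneg.2 hs
    have h2 : 0 ≤ s - τ := (sub_pos.2 h).le
    positivity
  · simp

/-- Tonelli: integrating the norm in `s` first gives the Beta constant times `(t - τ)^(a+b-1) ‖f
τ‖`, which `hf` makes integrable. -/
lemma integrable_abelKernel [CompleteSpace E] {a b : ℝ} (ha : 0 < a) (hb : 0 < b) {t : ℝ} {f : ℝ → E}
    (hm : AEStronglyMeasurable f (volume.restrict (Ioc 0 t)))
    (hf : IntegrableOn (fun τ => (t - τ) ^ (a + b - 1) • f τ) (Ioc 0 t)) :
    Integrable (Function.uncurry (abelKernel a b t f))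
      ((volume.restrict (Ioc 0 t)).prod (volume.restrict (Ioc 0 t))) := by
  have hIoo : ∀ᵐ τ ∂(volume.restrict (Ioc 0 t)), τ ∈ Ioo 0 t := by
    rw [← restrict_Ioo_eq_restrict_Ioc]
    exact ae_restrict_mem measurableSet_Ioo
  have hmeas : AEStronglyMeasurable (Function.uncurry (abelKernel a b t f))
      ((volume.restrict (Ioc 0 t)).prod (volume.restrict (Ioc 0 t))) := by
    have : Function.uncurry (abelKernel a b t f) = {p : ℝ × ℝ | p.2 < p.1}.indicator
        (fun p => ((t - p.1) ^ (a - 1) * (p.1 - p.2) ^ (b - 1)) • f p.2) := by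
      ext p
      simp [Function.uncurry, abelKernel, indicator_apply]
    rw [this]
    refine AEStronglyMeasurable.indicator ?_ (measurableSet_lt measurable_snd measurable_fst)
    refine AEStronglyMeasurable.smul ?_ hm.comp_snd
    apply Measurable.aestronglyMeasurable
    fun_prop
  rw [integrable_prod_iff' hmeas]
  refine ⟨hIoo.mono fun τ hτ => (abelKernel_integral_fst ha hb f hτ).1, ?_⟩
  refine (hf.norm.const_mul (ProbabilityTheory.beta a b)).congr ?_
  filter_upwards [hIoo] with τ hτ
  have e := (abelKernel_integral_fst ha hb (fun τ => ‖f τ‖) hτ).2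
  rw [norm_smul, Real.norm_of_nonneg (Real.rpow_nonneg (sub_pos.2 hτ.2).le _)]
  simp only [smul_eq_mul] at e
  rw [← e]
  refine setIntegral_congr_fun measurableSet_Ioc fun s hs => ?_
  exact (norm_abelKernel a b hs.2 f τ).symm

/-- The semigroup law of the Riemann–Liouville integrals. -/
theorem fracInt_fracInt [CompleteSpace E] {a b : ℝ} (ha : 0 < a) (hb : 0 < b) {t : ℝ} (ht : 0 ≤ t) {f : ℝ → E}
    (hm : AEStronglyMeasurable f (volume.restrict (Ioc 0 t)))
    (hf : IntegrableOn (fun τ => (t - τ) ^ (a + b - 1) • f τ) (Ioc 0 t)) :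
    fracInt a (fracInt b f) t = fracInt (a + b) f t := by
  have hsw := integral_integral_swap (integrable_abelKernel ha hb hm hf)
  have e1 : ∫ s in Ioc 0 t, ∫ τ in Ioc 0 t, abelKernel a b t f s τ
      = ∫ s in Ioc 0 t, (t - s) ^ (a - 1) • ∫ τ in (0 : ℝ)..s, ((s - τ) ^ (b - 1) : ℝ) • f τ :=
    setIntegral_congr_fun measurableSet_Ioc fun s hs => abelKernel_integral_snd a b f hs
  have e2 : ∫ τ in Ioc 0 t, ∫ s in Ioc 0 t, abelKernel a b t f s τ
      = ProbabilityTheory.beta a b • ∫ τ in Ioc 0 t, (t - τ) ^ (a + b - 1) • f τ := by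
    -- The Beta integral is available only for `τ < t`, so the endpoint is dropped.
    rw [integral_Ioc_eq_integral_Ioo, integral_Ioc_eq_integral_Ioo (y := t), ← integral_smul]
    exact setIntegral_congr_fun measurableSet_Ioo fun τ hτ => (abelKernel_integral_fst ha hb f hτ).2
  rw [e1, e2] at hsw
  unfold fracInt
  simp_rw [smul_comm _ (Real.Gamma b)⁻¹]
  rw [intervalIntegral.integral_smul, intervalIntegral.integral_of_le ht, hsw,
    intervalIntegral.integral_of_le ht, smul_smul, smul_smul]
  congr 1
  unfold ProbabilityTheory.beta
  have := (Real.Gamma_pos_of_pos ha).ne'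
  have := (Real.Gamma_pos_of_pos hb).ne'
  field_simp

/-- With outer order `1` the outer kernel is constant, and Fubini's theorem itself yields
integrability of the inner integral. -/
lemma integrableOn_fracInt [CompleteSpace E] {b : ℝ} (hb : 0 < b) {t : ℝ} {f : ℝ → E}
    (hf : IntegrableOn f (Ioc 0 t)) (hf' : IntegrableOn (fun τ => (t - τ) ^ b • f τ) (Ioc 0 t)) :
    IntegrableOn (fracInt b f) (Ioc 0 t) := by
  have h := (integrable_abelKernel one_pos hb hf.aestronglyMeasurable
    (by simpa using hf')).integral_prod_left
  have h2 := h.smul (Real.Gamma b)⁻¹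
  refine h2.congr ?_
  filter_upwards [ae_restrict_mem measurableSet_Ioc] with s hs
  simp only [Function.uncurry, Pi.smul_apply]
  rw [abelKernel_integral_snd 1 b f hs]
  simp [fracInt]

lemma fracInt_one (f : ℝ → E) (t : ℝ) : fracInt 1 f t = ∫ s in (0 : ℝ)..t, f s := by
  simp [fracInt]

lemma fracInt_congr {a t : ℝ} (ht : 0 ≤ t) {f g : ℝ → E} (h : ∀ s ∈ Icc 0 t, f s = g s) :
    fracInt a f t = fracInt a g t := by
  unfold fracInt
  congr 1
  apply intervalIntegral.integral_congr
  intro s hs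
  rw [uIcc_of_le ht] at hs
  simp only [h s hs]

lemma intervalIntegrable_rpow_sub_smul {a t : ℝ} (ha : 0 < a) {f : ℝ → E} (hf : Continuous f) :
    IntervalIntegrable (fun s => (t - s) ^ (a - 1) • f s) volume 0 t :=
  (intervalIntegrable_rpow_sub ha t).smul_continuousOn hf.continuousOn

theorem fracInt_fracInt_of_continuous [CompleteSpace E] {a b : ℝ} (ha : 0 < a) (hb : 0 < b) {t : ℝ} (ht : 0 ≤ t)
    {f : ℝ → E} (hf : Continuous f) :
    fracInt a (fracInt b f) t = fracInt (a + b) f t :=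
  fracInt_fracInt ha hb ht hf.aestronglyMeasurable
    ((intervalIntegrable_iff_integrableOn_Ioc_of_le ht).1
      (intervalIntegrable_rpow_sub_smul (add_pos ha hb) hf))

lemma fracInt_sub_of_continuous {a : ℝ} (ha : 0 < a) (t : ℝ) {f g : ℝ → E} (hf : Continuous f)
    (hg : Continuous g) :
    fracInt a (fun s => f s - g s) t = fracInt a f t - fracInt a g t := by
  unfold fracInt
  rw [← smul_sub, ← intervalIntegral.integral_sub (intervalIntegrable_rpow_sub_smul ha hf)
    (intervalIntegrable_rpow_sub_smul ha hg)]
  simp_rw [smul_sub]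

lemma fracInt_const_smul {𝕜 : Type*} [RCLike 𝕜] [NormedSpace 𝕜 E] [SMulCommClass ℝ 𝕜 E]
    (a t : ℝ) (c : 𝕜) (f : ℝ → E) :
    fracInt a (fun s => c • f s) t = c • fracInt a f t := by
  unfold fracInt
  simp_rw [smul_comm _ c]
  rw [intervalIntegral.integral_smul, smul_comm]

lemma fracInt_const [CompleteSpace E] {a t : ℝ} (ha : 0 < a) (c : E) :
    fracInt a (fun _ => c) t = (t ^ a / Real.Gamma (a + 1)) • c := by
  unfold fracInt
  rw [intervalIntegral.integral_smul_const, smul_smul]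
  congr 1
  have := intervalIntegral.integral_comp_sub_left (a := 0) (b := t) (fun x : ℝ => x ^ (a - 1)) t
  rw [this, sub_self, sub_zero, integral_rpow (Or.inl (by linarith)), sub_add_cancel,
    Real.zero_rpow ha.ne', Real.Gamma_add_one ha.ne', sub_zero]
  field_simp

lemma continuous_fracInt {a : ℝ} (ha : 1 ≤ a) {f : ℝ → E} (hf : Continuous f) :
    Continuous (fracInt a f) := by
  unfold fracInt
  refine Continuous.const_smul (intervalIntegral.continuous_parametric_intervalIntegral_of_continuous
    (f := fun t s => ((t - s) ^ (a - 1) : ℝ) • f s) ?_ continuous_id) _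
  have : Continuous fun x : ℝ => x ^ (a - 1) := Real.continuous_rpow_const (by linarith)
  simp only [Function.uncurry_def]
  fun_prop

end FractionalIntegral

/-! ### Regularity of solutions of the relaxation equation. -/

lemma eqOn_Icc_of_integral_eq {T : ℝ} (hT : 0 < T) {y Q : ℝ → ℝ} (hy : Continuous y)
    (hQ : Continuous Q) (h : ∀ t ∈ Icc 0 T, ∫ s in (0 : ℝ)..t, y s = ∫ s in (0 : ℝ)..t, Q s) :
    EqOn y Q (Icc 0 T) := by
  have h1 : EqOn y Q (Ioo 0 T) := by
    intro t ht
    have d1 := hy.deriv_integral y 0 t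
    have d2 := hQ.deriv_integral Q 0 t
    rw [← d1, ← d2]
    apply Filter.EventuallyEq.deriv_eq
    filter_upwards [Icc_mem_nhds ht.1 ht.2] with s hs using h s hs
  have h2 := h1.closure hy hQ
  rwa [closure_Ioo hT.ne] at h2

/-- The equation `D^ρ y = c - λ y`, `y(0) = 0`, in integrated form. -/
def IntegratedRelaxation (ρ T c lam : ℝ) (y : ℝ → ℝ) : Prop :=
  ∀ t ∈ Icc 0 T, fracInt (1 - ρ) y t = ∫ s in (0 : ℝ)..t, (c - lam * y s)

/-- Apply `I^ρ` to both sides: the left becomes `I^1 y`, the right gains order `ρ`. -/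
lemma IntegratedRelaxation.integral_eq {ρ T c lam : ℝ} (hρ : 0 < ρ) (hρ1 : ρ < 1) {y : ℝ → ℝ}
    (hy : Continuous y) (h : IntegratedRelaxation ρ T c lam y) {t : ℝ} (ht : t ∈ Icc 0 T) :
    ∫ s in (0 : ℝ)..t, y s
      = fracInt (1 + ρ) (fun _ => c) t - lam * fracInt (1 + ρ) y t := by
  have e1 : fracInt ρ (fracInt (1 - ρ) y) t = ∫ s in (0 : ℝ)..t, y s := by
    rw [fracInt_fracInt_of_continuous hρ (by linarith) ht.1 hy, add_sub_cancel, fracInt_one]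
  have e2 : fracInt ρ (fracInt (1 - ρ) y) t = fracInt ρ (fracInt 1 (fun s => c - lam * y s)) t := by
    apply fracInt_congr ht.1
    intro s hs
    rw [h s ⟨hs.1, hs.2.trans ht.2⟩, fracInt_one]
  rw [← e1, e2, fracInt_fracInt_of_continuous hρ one_pos ht.1 (by fun_prop),
    fracInt_sub_of_continuous (by linarith) t (by fun_prop) (by fun_prop), add_comm ρ 1]
  congr 1
  exact fracInt_const_smul (1 + ρ) t lam y

/-- Iterates `IntegratedRelaxation.integral_eq`: each substitution moves one more power of `t` into
`Q` and raises the order of the remainder by `ρ`. -/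
lemma IntegratedRelaxation.exists_expansion {ρ T c lam : ℝ} (hρ : 0 < ρ) (hρ1 : ρ < 1) {y : ℝ → ℝ}
    (hy : Continuous y) (h : IntegratedRelaxation ρ T c lam y) (n : ℕ) :
    ∃ Q : ℝ → ℝ, Continuous Q ∧ (∀ t, 0 < t → DifferentiableAt ℝ Q t) ∧
      ∀ t ∈ Icc 0 T, ∫ s in (0 : ℝ)..t, y s
        = (∫ s in (0 : ℝ)..t, Q s) + (-lam) ^ (n + 1) * fracInt (1 + (n + 1) * ρ) y t := by
  have hconst : ∀ β : ℝ, 0 < β → ∀ t, 0 ≤ t →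
      ∫ s in (0 : ℝ)..t, s ^ β / Real.Gamma (β + 1) * c = fracInt (1 + β) (fun _ => c) t := by
    intro β hβ t ht
    rw [← fracInt_fracInt_of_continuous one_pos hβ ht continuous_const, fracInt_one]
    simp_rw [fracInt_const hβ, smul_eq_mul]
  have hcont : ∀ β : ℝ, 0 < β → Continuous fun s : ℝ => s ^ β / Real.Gamma (β + 1) * c := by
    intro β hβ
    have := Real.continuous_rpow_const hβ.le
    fun_prop
  have hdiff : ∀ β t : ℝ, 0 < t →
      DifferentiableAt ℝ (fun s : ℝ => s ^ β / Real.Gamma (β + 1) * c) t := by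
    intro β t ht
    have := Real.differentiableAt_rpow_const_of_ne β ht.ne'
    fun_prop
  induction n with
  | zero =>
    refine ⟨_, hcont ρ hρ, hdiff ρ, fun t ht => ?_⟩
    rw [h.integral_eq hρ hρ1 hy ht, hconst ρ hρ t ht.1]
    simp; ring
  | succ n ih =>
    obtain ⟨Q, hQc, hQd, hQ⟩ := ih
    have hβ : 0 < (n + 2 : ℝ) * ρ := by positivity
    have hβ' : 0 < (n + 1 : ℝ) * ρ := by positivity
    refine ⟨fun s => Q s + (-lam) ^ (n + 1) *
      (s ^ ((n + 2 : ℝ) * ρ) / Real.Gamma ((n + 2 : ℝ) * ρ + 1) * c),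
      hQc.add (continuous_const.mul (hcont _ hβ)),
      fun t ht => (hQd t ht).add ((hdiff _ t ht).const_mul _), fun t ht => ?_⟩
    beta_reduce
    rw [hQ t ht, intervalIntegral.integral_add (hQc.intervalIntegrable _ _)
      (((hcont _ hβ).intervalIntegrable _ _).const_mul _),
      intervalIntegral.integral_const_mul, hconst _ hβ t ht.1]
    -- Peel `I^1 y` off the remainder and replace it by its expression from the equation.
    have e1 : fracInt (1 + (n + 1) * ρ) y t
        = fracInt ((n + 1) * ρ) (fracInt (1 + ρ) (fun s => c - lam * y s)) t := by
      rw [add_comm, ← fracInt_fracInt_of_continuous hβ' one_pos ht.1 hy]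
      apply fracInt_congr ht.1
      intro s hs
      rw [fracInt_one, h.integral_eq hρ hρ1 hy ⟨hs.1, hs.2.trans ht.2⟩,
        fracInt_sub_of_continuous (by linarith) s (by fun_prop) (by fun_prop)]
      congr 1
      exact (fracInt_const_smul (1 + ρ) s lam y).symm
    have e2 : fracInt (1 + (n + 1) * ρ) y t = fracInt (1 + (n + 2) * ρ) (fun _ => c) t
        - lam * fracInt (1 + (n + 2) * ρ) y t := by
      rw [e1, fracInt_fracInt_of_continuous hβ' (by linarith) ht.1 (by fun_prop),
        show (n + 1 : ℝ) * ρ + (1 + ρ) = 1 + (n + 2) * ρ by ring,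
        fracInt_sub_of_continuous (by linarith) t (by fun_prop) (by fun_prop)]
      congr 1
      exact fracInt_const_smul _ t lam y
    rw [e2]
    push_cast
    rw [show (n + 1 + 1 : ℝ) = n + 2 by ring]
    ring

/-- `I^a f` is the primitive of `I^{a-1} f`; the bound `2 ≤ a` makes the kernel of the latter
continuous. -/
lemma hasDerivAt_fracInt {a : ℝ} (ha : 2 ≤ a) {f : ℝ → ℝ} (hf : Continuous f) {t : ℝ}
    (ht : 0 < t) : HasDerivAt (fracInt a f) (fracInt (a - 1) f t) t := by
  have hc : Continuous (fracInt (a - 1) f) := continuous_fracInt (by linarith) hf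
  have e : fracInt a f =ᶠ[𝓝 t] fun t => ∫ s in (0 : ℝ)..t, fracInt (a - 1) f s := by
    filter_upwards [lt_mem_nhds ht] with s hs
    rw [← fracInt_one, fracInt_fracInt_of_continuous one_pos (by linarith) hs.le hf,
      add_sub_cancel]
  exact (intervalIntegral.integral_hasDerivAt_right (hc.intervalIntegrable _ _)
    hc.stronglyMeasurable.stronglyMeasurableAtFilter hc.continuousAt).congr_of_eventuallyEq e

/-- Solutions of the relaxation equation agree on `[0, T]` with functions that are differentiable
at positive times. -/
lemma IntegratedRelaxation.exists_differentiable {ρ T c lam : ℝ} (hT : 0 < T) (hρ : 0 < ρ)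
    (hρ1 : ρ < 1) {y : ℝ → ℝ} (hy : Continuous y) (h : IntegratedRelaxation ρ T c lam y) :
    ∃ Q : ℝ → ℝ, (∀ t, 0 < t → DifferentiableAt ℝ Q t) ∧ EqOn y Q (Icc 0 T) := by
  obtain ⟨n, hn⟩ := exists_nat_gt (2 / ρ)
  have hn2 : 2 ≤ (n + 1 : ℝ) * ρ := by
    rw [div_lt_iff₀ hρ] at hn
    nlinarith
  obtain ⟨Q, hQc, hQd, hQ⟩ := h.exists_expansion hρ hρ1 hy n
  have hc : Continuous (fracInt ((n + 1) * ρ) y) := continuous_fracInt (by linarith) hy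
  refine ⟨fun t => Q t + (-lam) ^ (n + 1) * fracInt ((n + 1) * ρ) y t, fun t ht =>
    (hQd t ht).add ((hasDerivAt_fracInt hn2 hy ht).differentiableAt.const_mul _), ?_⟩
  refine eqOn_Icc_of_integral_eq hT hy (by fun_prop) fun t ht => ?_
  rw [hQ t ht, intervalIntegral.integral_add (hQc.intervalIntegrable _ _)
    ((hc.intervalIntegrable _ _).const_mul _), intervalIntegral.integral_const_mul,
    ← fracInt_one (fracInt _ _), fracInt_fracInt_of_continuous one_pos (by linarith) ht.1 hy]

/-! ### Extremum principle and uniqueness for the relaxation equation. -/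

/-- Only left difference quotients are used, so that `t₀` may be the final time `T`. -/
lemma le_zero_of_increment_le {g : ℝ → ℝ} (hg : Continuous g) {t₀ : ℝ} {ε : ℝ → ℝ}
    (hε : Tendsto ε (𝓝[>] 0) (𝓝 0))
    (h : ∀ᶠ r in 𝓝[>] (0 : ℝ), (∫ s in (0 : ℝ)..t₀, g s) - (∫ s in (0 : ℝ)..(t₀ - r), g s) ≤ r * ε r) :
    g t₀ ≤ 0 := by
  have hd : HasDerivAt (fun t => ∫ s in (0 : ℝ)..t, g s) (g t₀) t₀ :=
    intervalIntegral.integral_hasDerivAt_right (hg.intervalIntegrable _ _)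
      hg.stronglyMeasurable.stronglyMeasurableAtFilter hg.continuousAt
  have hd' : HasDerivAt (fun r => ∫ s in (0 : ℝ)..(t₀ - r), g s) (-g t₀) 0 := by
    have hd0 : HasDerivAt (fun t => ∫ s in (0 : ℝ)..t, g s) (g t₀) (t₀ - 0) := by simpa using hd
    have := hd0.scomp 0 ((hasDerivAt_id (0 : ℝ)).const_sub t₀)
    simpa [Function.comp_def] using this
  have hs := hd'.tendsto_slope_zero_right
  simp only [zero_add, sub_zero, smul_eq_mul] at hs
  have := hs.neg
  rw [neg_neg] at this
  refine le_of_tendsto_of_tendsto this hε ?_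
  filter_upwards [h, self_mem_nhdsWithin] with r hr hr0
  have hr0 : 0 < r := hr0
  rw [← mul_neg, neg_sub, inv_mul_le_iff₀ hr0]
  exact hr

/-- Since `a < 1`, the kernel `(t - s)^(a-1)` decreases in `t`, so the past `[0, t₀ - r]`
contributes a nonpositive increment. On the new piece `[t₀ - r, t₀]` the linear bound on `z` cancels
the singularity. -/
lemma fracInt_sub_le_of_nonneg {a t₀ r C : ℝ} (ha : 0 < a) (ha1 : a < 1) (hr : 0 < r)
    (hrt : r < t₀) {z : ℝ → ℝ} (hz : Continuous z) (hz0 : ∀ s ∈ Icc 0 t₀, 0 ≤ z s)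
    (hC : ∀ s ∈ Icc (t₀ - r) t₀, z s ≤ C * (t₀ - s)) :
    fracInt a z t₀ - fracInt a z (t₀ - r) ≤ (Real.Gamma a)⁻¹ * (r * (C * r ^ a)) := by
  have hi : IntervalIntegrable (fun s => (t₀ - s) ^ (a - 1) • z s) volume 0 t₀ :=
    intervalIntegrable_rpow_sub_smul ha hz
  have hi1 : IntervalIntegrable (fun s => (t₀ - s) ^ (a - 1) • z s) volume 0 (t₀ - r) :=
    hi.mono_set (by rw [uIcc_of_le (by linarith), uIcc_of_le (by linarith)]
                    exact Icc_subset_Icc_right (by linarith))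
  have hi2 : IntervalIntegrable (fun s => (t₀ - s) ^ (a - 1) • z s) volume (t₀ - r) t₀ :=
    hi.mono_set (by rw [uIcc_of_le (by linarith), uIcc_of_le (by linarith)]
                    exact Icc_subset_Icc_left (by linarith))
  unfold fracInt
  rw [← smul_sub, smul_eq_mul]
  refine mul_le_mul_of_nonneg_left ?_ (inv_nonneg.2 (Real.Gamma_pos_of_pos ha).le)
  rw [← intervalIntegral.integral_add_adjacent_intervals hi1 hi2]
  have h1 : ∫ s in (0 : ℝ)..(t₀ - r), (t₀ - s) ^ (a - 1) • z s
      ≤ ∫ s in (0 : ℝ)..(t₀ - r), (t₀ - r - s) ^ (a - 1) • z s := by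
    refine intervalIntegral.integral_mono_on_of_le_Ioo (by linarith) hi1
      (intervalIntegrable_rpow_sub_smul ha hz) fun s hs => ?_
    simp only [smul_eq_mul]
    refine mul_le_mul_of_nonneg_right ?_ (hz0 s ⟨hs.1.le, by linarith [hs.2]⟩)
    exact Real.rpow_le_rpow_of_nonpos (by linarith [hs.2]) (by linarith) (by linarith)
  have h2 : ∫ s in (t₀ - r)..t₀, (t₀ - s) ^ (a - 1) • z s ≤ r * (C * r ^ a) := by
    have : ∫ s in (t₀ - r)..t₀, (t₀ - s) ^ (a - 1) • z s ≤ ∫ s in (t₀ - r)..t₀, C * r ^ a := by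
      refine intervalIntegral.integral_mono_on_of_le_Ioo (by linarith) hi2
        intervalIntegrable_const fun s hs => ?_
      have hp : 0 < t₀ - s := by linarith [hs.2]
      have hCn : 0 ≤ C := by
        have h1 := hC s ⟨hs.1.le, hs.2.le⟩
        have h2 := hz0 s ⟨by linarith [hs.1], hs.2.le⟩
        by_contra hneg
        push Not at hneg
        nlinarith
      calc (t₀ - s) ^ (a - 1) • z s ≤ (t₀ - s) ^ (a - 1) * (C * (t₀ - s)) :=
            mul_le_mul_of_nonneg_left (hC s ⟨hs.1.le, hs.2.le⟩) (by positivity)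
        _ = C * (t₀ - s) ^ a := by
            rw [Real.rpow_sub_one hp.ne']; field_simp
        _ ≤ C * r ^ a := by
            refine mul_le_mul_of_nonneg_left ?_ hCn
            exact Real.rpow_le_rpow hp.le (by linarith [hs.1]) ha.le
    simpa [mul_left_comm] using this
  linarith

/-- Extremum principle: at a nonpositive minimum at a positive time the fractional derivative of
order `ρ < 1` is nonpositive. -/
lemma IntegratedRelaxation.le_of_isMin {ρ T c lam : ℝ} (hT : 0 < T) (hρ : 0 < ρ)
    (hρ1 : ρ < 1) {y : ℝ → ℝ} (hy : Continuous y) (h : IntegratedRelaxation ρ T c lam y)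
    {t₀ : ℝ} (ht₀ : t₀ ∈ Ioc 0 T) (hmin : ∀ s ∈ Icc 0 T, y t₀ ≤ y s) (hy0 : y t₀ ≤ 0) :
    c - lam * y t₀ ≤ 0 := by
  obtain ⟨Q, hQd, hQ⟩ := h.exists_differentiable hT hρ hρ1 hy
  have hQ0 : Q t₀ = y t₀ := (hQ ⟨ht₀.1.le, ht₀.2⟩).symm
  -- The bound is taken for `Q`, because `y` itself may fail to be differentiable at `t₀ = T`.
  obtain ⟨C, hC⟩ := ((hQd t₀ ht₀.1).isBigO_sub).bound
  obtain ⟨δ, hδ, hball⟩ := Metric.eventually_nhds_iff.1 hC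
  refine le_zero_of_increment_le (g := fun s => c - lam * y s) (by fun_prop)
    (ε := fun r => (Real.Gamma (1 - ρ))⁻¹ * (C * r ^ (1 - ρ))) ?_ ?_
  · have : Tendsto (fun r : ℝ => (Real.Gamma (1 - ρ))⁻¹ * (C * r ^ (1 - ρ))) (𝓝 0)
        (𝓝 ((Real.Gamma (1 - ρ))⁻¹ * (C * 0 ^ (1 - ρ)))) :=
      ((Real.continuousAt_rpow_const 0 (1 - ρ) (Or.inr (by linarith))).tendsto.const_mul C).const_mul _
    rw [Real.zero_rpow (by linarith), mul_zero, mul_zero] at this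
    exact this.mono_left nhdsWithin_le_nhds
  · filter_upwards [Ioo_mem_nhdsGT (lt_min hδ ht₀.1)] with r hr
    have hrδ : r < δ := hr.2.trans_le (min_le_left _ _)
    have hrt : r < t₀ := hr.2.trans_le (min_le_right _ _)
    rw [← h t₀ ⟨ht₀.1.le, ht₀.2⟩, ← h (t₀ - r) ⟨by linarith, by linarith [ht₀.2, hr.1]⟩]
    have key := fracInt_sub_le_of_nonneg (a := 1 - ρ) (t₀ := t₀) (r := r) (C := C)
      (z := fun s => y s - y t₀)
      (by linarith) (by linarith) hr.1 hrt (by fun_prop)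
      (fun s hs => sub_nonneg.2 (hmin s ⟨hs.1, hs.2.trans ht₀.2⟩)) (fun s hs => by
        have hs0 : s ∈ Icc 0 T := ⟨by linarith [hs.1], hs.2.trans ht₀.2⟩
        have hd : dist s t₀ < δ := by
          rw [Real.dist_eq, abs_sub_comm, abs_of_nonneg (by linarith [hs.2])]
          linarith [hs.1]
        have := hball hd
        rw [hQ0, ← hQ hs0, Real.norm_eq_abs, Real.norm_eq_abs, abs_sub_comm s,
          abs_of_nonneg (sub_nonneg.2 hs.2)] at this
        exact (le_abs_self _).trans this)
    rw [fracInt_sub_of_continuous (by linarith) _ hy continuous_const,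
      fracInt_sub_of_continuous (by linarith) _ hy continuous_const,
      fracInt_const (by linarith), fracInt_const (by linarith)] at key
    -- The shift by the constant `y t₀` changes the increment by `y t₀` times a nonnegative
    -- quantity; this is where `y t₀ ≤ 0` enters.
    have hmono : (t₀ - r) ^ (1 - ρ) / Real.Gamma (1 - ρ + 1) ≤ t₀ ^ (1 - ρ) / Real.Gamma (1 - ρ + 1) := by
      refine div_le_div_of_nonneg_right ?_ (Real.Gamma_pos_of_pos (by linarith)).le
      exact Real.rpow_le_rpow (by linarith) (by linarith [hr.1]) (by linarith)
    simp only [smul_eq_mul] at key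
    have := mul_le_mul_of_nonpos_right hmono hy0
    linarith

/-- A nonpositive extremum principle forces the data of the relaxation problem with zero values at
both ends to vanish. -/
lemma eq_zero_of_extremum {T c lam : ℝ} (hT : 0 < T) (hlam : 0 ≤ lam) {y : ℝ → ℝ}
    (hy : Continuous y) (hy0 : y 0 = 0) (hyT : y T = 0)
    (hmin : ∀ t₀ ∈ Ioc 0 T, (∀ s ∈ Icc 0 T, y t₀ ≤ y s) → y t₀ ≤ 0 → c - lam * y t₀ ≤ 0) :
    c ≤ 0 ∧ (0 ≤ c → 0 < lam → ∀ t ∈ Icc 0 T, 0 ≤ y t) := by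
  obtain ⟨t₀, ht₀, hm⟩ := isCompact_Icc.exists_isMinOn (nonempty_Icc.2 hT.le) hy.continuousOn
  have hle : y t₀ ≤ 0 := hy0 ▸ hm (left_mem_Icc.2 hT.le)
  -- A minimum at time `0` is also attained at `T`, since both end values are `0`.
  have hex : ∃ t₁ ∈ Ioc 0 T, y t₁ = y t₀ := by
    rcases ht₀.1.eq_or_lt with h | h
    · exact ⟨T, right_mem_Ioc.2 hT, by rw [hyT, ← h, hy0]⟩
    · exact ⟨t₀, ⟨h, ht₀.2⟩, rfl⟩
  obtain ⟨t₁, ht₁, he⟩ := hex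
  have hm' : ∀ s ∈ Icc 0 T, y t₁ ≤ y s := fun s hs => he ▸ hm hs
  have key := hmin t₁ ht₁ hm' (he ▸ hle)
  rw [he] at key
  refine ⟨by nlinarith, fun hc hl t ht => ?_⟩
  have : 0 ≤ y t₀ := by
    by_contra hneg
    push Not at hneg
    nlinarith
  exact this.trans (hm ht)

lemma IntegratedRelaxation.neg {ρ T c lam : ℝ} {y : ℝ → ℝ} (h : IntegratedRelaxation ρ T c lam y) :
    IntegratedRelaxation ρ T (-c) lam (fun s => -y s) := by
  intro t ht
  have := fracInt_const_smul (1 - ρ) t (-1 : ℝ) y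
  simp only [smul_eq_mul, neg_one_mul] at this
  rw [this, h t ht, ← intervalIntegral.integral_neg]
  congr 1; ext s; ring

theorem IntegratedRelaxation.eq_zero {ρ T c lam : ℝ} (hT : 0 < T) (hρ : 0 < ρ)
    (hρ1 : ρ < 1) (hlam : 0 ≤ lam) {y : ℝ → ℝ} (hy : Continuous y) (hy0 : y 0 = 0) (hyT : y T = 0)
    (h : IntegratedRelaxation ρ T c lam y) :
    c = 0 ∧ ∀ t ∈ Icc 0 T, y t = 0 := by
  have h1 := eq_zero_of_extremum hT hlam hy hy0 hyT
    (fun t₀ ht₀ hm hl => h.le_of_isMin hT hρ hρ1 hy ht₀ hm hl)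
  have h2 := eq_zero_of_extremum (y := fun s => -y s) hT hlam hy.neg (by simp [hy0]) (by simp [hyT])
    (fun t₀ ht₀ hm hl => h.neg.le_of_isMin hT hρ hρ1 hy.neg ht₀ hm hl)
  have hc : c = 0 := le_antisymm h1.1 (by linarith [h2.1])
  refine ⟨hc, ?_⟩
  rcases hlam.eq_or_lt with hl | hl
  -- For `lam = 0` the sign argument says nothing about `y`, but with `c = 0` the equation gives `∫
  -- y = 0` on every `[0, t]`.
  · refine eqOn_Icc_of_integral_eq hT hy continuous_const fun t ht => ?_
    rw [h.integral_eq hρ hρ1 hy ht, hc, ← hl, fracInt_const (by linarith)]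
    simp
  · intro t ht
    have a1 := h1.2 (by rw [hc]) hl t ht
    have a2 := h2.2 (by simp [hc]) hl t ht
    linarith

/-- The case `ρ = 1` of `IntegratedRelaxation.eq_zero`. -/
theorem eq_zero_of_integrated_ode {T c lam : ℝ} (hT : 0 < T) (hlam : 0 ≤ lam) {y : ℝ → ℝ}
    (hy : Continuous y) (hyT : y T = 0)
    (h : ∀ t ∈ Icc 0 T, y t = ∫ s in (0 : ℝ)..t, (c - lam * y s)) :
    c = 0 ∧ ∀ t ∈ Icc 0 T, y t = 0 := by
  have aux : ∀ (c : ℝ) (y : ℝ → ℝ), Continuous y →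
      (∀ t ∈ Icc 0 T, y t = ∫ s in (0 : ℝ)..t, (c - lam * y s)) →
      ∀ t₀ ∈ Ioc 0 T, (∀ s ∈ Icc 0 T, y t₀ ≤ y s) → y t₀ ≤ 0 → c - lam * y t₀ ≤ 0 := by
    intro c y hy h t₀ ht₀ hm _
    refine le_zero_of_increment_le (g := fun s => c - lam * y s) (by fun_prop)
      (ε := fun _ => 0) tendsto_const_nhds ?_
    filter_upwards [Ioo_mem_nhdsGT ht₀.1] with r hr
    have hm1 : t₀ - r ∈ Icc 0 T := ⟨by linarith [hr.2], by linarith [hr.1, ht₀.2]⟩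
    rw [← h t₀ ⟨ht₀.1.le, ht₀.2⟩, ← h _ hm1]
    linarith [hm _ hm1]
  have hy0 : y 0 = 0 := by simpa using h 0 (left_mem_Icc.2 hT.le)
  have hneg : ∀ t ∈ Icc 0 T, -y t = ∫ s in (0 : ℝ)..t, (-c - lam * -y s) := by
    intro t ht
    rw [h t ht, ← intervalIntegral.integral_neg]
    congr 1; ext s; ring
  have h1 := eq_zero_of_extremum hT hlam hy hy0 hyT (aux c y hy h)
  have h2 := eq_zero_of_extremum (y := fun s => -y s) hT hlam hy.neg (by simp [hy0]) (by simp [hyT])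
    (aux (-c) _ hy.neg hneg)
  have hc : c = 0 := le_antisymm h1.1 (by linarith [h2.1])
  refine ⟨hc, fun t ht => ?_⟩
  rcases hlam.eq_or_lt with hl | hl
  · rw [h t ht, hc, ← hl]; simp
  · have a1 := h1.2 (by rw [hc]) hl t ht
    have a2 := h2.2 (by simp [hc]) hl t ht
    linarith

/-! ### Absolutely continuous functions and the primitive of the Caputo derivative. -/

lemma absolutelyContinuousOnInterval_comp_lipschitz {X Y : Type*} [PseudoMetricSpace X]
    [PseudoMetricSpace Y] {L : X → Y} (hL : LipschitzWith 1 L) {g : ℝ → X} {a b : ℝ}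
    (hg : AbsolutelyContinuousOnInterval g a b) :
    AbsolutelyContinuousOnInterval (fun s => L (g s)) a b := by
  rw [absolutelyContinuousOnInterval_iff] at hg ⊢
  intro ε hε
  obtain ⟨δ, hδ, h⟩ := hg ε hε
  refine ⟨δ, hδ, fun E hE hlt => lt_of_le_of_lt (Finset.sum_le_sum fun i _ => ?_) (h E hE hlt)⟩
  simpa using hL.dist_le_mul (g (E.2 i).1) (g (E.2 i).2)

lemma absolutelyContinuousOnInterval_re {g : ℝ → ℂ} {a b : ℝ}
    (hg : AbsolutelyContinuousOnInterval g a b) :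
    AbsolutelyContinuousOnInterval (fun s => (g s).re) a b :=
  absolutelyContinuousOnInterval_comp_lipschitz
    (LipschitzWith.of_dist_le_mul fun x y => by
      simpa [Complex.dist_eq, Real.dist_eq] using Complex.abs_re_le_norm (x - y)) hg

lemma absolutelyContinuousOnInterval_im {g : ℝ → ℂ} {a b : ℝ}
    (hg : AbsolutelyContinuousOnInterval g a b) :
    AbsolutelyContinuousOnInterval (fun s => (g s).im) a b :=
  absolutelyContinuousOnInterval_comp_lipschitz
    (LipschitzWith.of_dist_le_mul fun x y => by
      simpa [Complex.dist_eq, Real.dist_eq] using Complex.abs_im_le_norm (x - y)) hg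

/-- The fundamental theorem of calculus for complex-valued absolutely continuous functions. -/
theorem integral_deriv_of_absolutelyContinuous {g : ℝ → ℂ} {a b : ℝ} (hab : a ≤ b)
    (hg : AbsolutelyContinuousOnInterval g a b) :
    IntervalIntegrable (deriv g) volume a b ∧ ∫ s in a..b, deriv g s = g b - g a := by
  have hr := absolutelyContinuousOnInterval_re hg
  have hi := absolutelyContinuousOnInterval_im hg
  have hae : ∀ᵐ s ∂(volume.restrict (Ioc a b)), deriv g s
      = ((deriv (fun s => (g s).re) s : ℝ) : ℂ) + ((deriv (fun s => (g s).im) s : ℝ) : ℂ) * Complex.I := by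
    rw [ae_restrict_iff' measurableSet_Ioc]
    filter_upwards [hr.ae_differentiableAt, hi.ae_differentiableAt] with s h1 h2 hs
    have hs' : s ∈ uIcc a b := by rw [uIcc_of_le hab]; exact Ioc_subset_Icc_self hs
    have d := ((h1 hs').hasDerivAt.ofReal_comp).add (((h2 hs').hasDerivAt.ofReal_comp).mul_const Complex.I)
    have e : ((fun s => (((g s).re : ℝ) : ℂ)) + fun s => (((g s).im : ℝ) : ℂ) * Complex.I) = g := by
      ext s; simp [Complex.re_add_im]
    rw [← d.deriv]
    exact congrArg (fun f => deriv f s) e.symm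
  have hofReal : ∀ {φ : ℝ → ℝ}, IntervalIntegrable φ volume a b →
      IntervalIntegrable (fun s => (φ s : ℂ)) volume a b := fun h => ⟨h.1.ofReal, h.2.ofReal⟩
  have ir := hofReal hr.intervalIntegrable_deriv
  have ii := (hofReal hi.intervalIntegrable_deriv).mul_const Complex.I
  have hae' : ∀ᵐ s, s ∈ uIoc a b → deriv g s
      = ((deriv (fun s => (g s).re) s : ℝ) : ℂ) + ((deriv (fun s => (g s).im) s : ℝ) : ℂ) * Complex.I := by
    rw [uIoc_of_le hab]; exact (ae_restrict_iff' measurableSet_Ioc).1 hae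
  constructor
  · refine (ir.add ii).congr_ae ?_
    rw [uIoc_of_le hab]
    filter_upwards [hae] with s hs using hs.symm
  · rw [intervalIntegral.integral_congr_ae hae']
    have h1 := hr.integral_deriv_eq_sub
    have h2 := hi.integral_deriv_eq_sub
    rw [intervalIntegral.integral_add ir ii, intervalIntegral.integral_mul_const, intervalIntegral.integral_ofReal,
      intervalIntegral.integral_ofReal, h1, h2]
    apply Complex.ext <;> simp

lemma caputoDeriv_eq_fracInt {ρ : ℝ} (hρ : ρ ≠ 1) (T : ℝ) (g : ℝ → ℂ) (t : ℝ) :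
    caputoDeriv ρ T g t = fracInt (1 - ρ) (deriv g) t := by
  rw [caputoDeriv, if_neg hρ, fracInt, one_div, Complex.real_smul]
  congr 3
  ext s
  rw [show 1 - ρ - 1 = -ρ by ring]

/-- By the semigroup law `I^1 I^{1-ρ} g' = I^{1-ρ} I^1 g'`, and `I^1 g' = g - g(0)` by absolute
continuity. -/
lemma integral_caputoDeriv {ρ T t : ℝ} (hρ1 : ρ < 1) (ht : 0 ≤ t) {g : ℝ → ℂ}
    (hg : AbsolutelyContinuousOnInterval g 0 t) :
    IntervalIntegrable (caputoDeriv ρ T g) volume 0 t ∧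
    ∫ s in (0 : ℝ)..t, caputoDeriv ρ T g s = fracInt (1 - ρ) (fun s => g s - g 0) t := by
  have hi := (integral_deriv_of_absolutelyContinuous ht hg).1
  have hf : caputoDeriv ρ T g = fracInt (1 - ρ) (deriv g) :=
    funext fun s => caputoDeriv_eq_fracInt hρ1.ne T g s
  have hc : Continuous fun s : ℝ => (t - s) ^ (1 - ρ) :=
    (Real.continuous_rpow_const (by linarith)).comp (by fun_prop)
  have hi2 : IntervalIntegrable (fun s => (t - s) ^ (1 - ρ) • deriv g s) volume 0 t :=
    hi.continuousOn_smul hc.continuousOn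
  have hiO := (intervalIntegrable_iff_integrableOn_Ioc_of_le ht).1 hi
  have hi2O := (intervalIntegrable_iff_integrableOn_Ioc_of_le ht).1 hi2
  rw [hf]
  constructor
  · exact (intervalIntegrable_iff_integrableOn_Ioc_of_le ht).2
      (integrableOn_fracInt (by linarith) hiO hi2O)
  · rw [← fracInt_one, fracInt_fracInt one_pos (by linarith) ht hiO.aestronglyMeasurable
      (by simpa using hi2O), add_comm, ← fracInt_fracInt (by linarith) one_pos ht
      hiO.aestronglyMeasurable (by simpa using hi2O)]
    apply fracInt_congr ht
    intro s hs
    rw [fracInt_one]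
    refine (integral_deriv_of_absolutelyContinuous hs.1 (hg.mono ?_)).2
    rw [uIcc_of_le hs.1, uIcc_of_le ht]
    exact Icc_subset_Icc_right hs.2

/-- The function `I^{1-ρ} (g - g(0))`, whose derivative is the Caputo derivative of `g`. -/
def caputoPrimitive (ρ : ℝ) (g : ℝ → ℂ) (t : ℝ) : ℂ :=
  if ρ = 1 then g t - g 0 else fracInt (1 - ρ) (fun s => g s - g 0) t

/-- The lower limit stays positive because the Caputo derivative is assumed continuous only on `(0,
T]`; for `ρ = 1` its integrability up to `0` is not given. -/
lemma caputoPrimitive_sub {ρ T ε t : ℝ} (hρ1 : ρ ≤ 1) (hε : 0 < ε) (hεt : ε ≤ t) (htT : t ≤ T)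
    {g : ℝ → ℂ} (hg : ∀ s ∈ Ioc 0 T, CaputoDifferentiableAt ρ T g s)
    (hc : ContinuousOn (caputoDeriv ρ T g) (Ioc 0 T)) :
    ∫ s in ε..t, caputoDeriv ρ T g s = caputoPrimitive ρ g t - caputoPrimitive ρ g ε := by
  have hsub : Icc ε t ⊆ Ioc 0 T := fun s hs => ⟨hε.trans_le hs.1, hs.2.trans htT⟩
  rcases hρ1.eq_or_lt with h | h
  · subst h
    have hd : ∀ s ∈ Ioc 0 T, HasDerivWithinAt g (caputoDeriv 1 T g s) (Icc 0 T) s := by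
      intro s hs
      have := hg s hs
      simp only [CaputoDifferentiableAt, if_true] at this
      simpa [caputoDeriv] using this.hasDerivWithinAt
    rw [intervalIntegral.integral_eq_sub_of_hasDerivAt_of_le hεt (f := g)]
    · simp [caputoPrimitive]
    · intro s hs
      exact (hd s (hsub hs)).continuousWithinAt.mono
        (fun r hr => Ioc_subset_Icc_self (hsub hr))
    · intro s hs
      exact (hd s (hsub (Ioo_subset_Icc_self hs))).hasDerivAt
        (Icc_mem_nhds (hε.trans hs.1) (hs.2.trans_le htT))
    · exact (hc.mono (by rw [uIcc_of_le hεt]; exact hsub)).intervalIntegrable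
  · have hac : ∀ s ∈ Ioc 0 T, AbsolutelyContinuousOnInterval g 0 s := by
      intro s hs
      have := hg s hs
      rw [CaputoDifferentiableAt, if_neg h.ne] at this
      exact this.1
    have h1 := integral_caputoDeriv (T := T) h (hε.le.trans hεt) (hac t ⟨hε.trans_le hεt, htT⟩)
    have h2 := integral_caputoDeriv (T := T) h hε.le (hac ε ⟨hε, hεt.trans htT⟩)
    rw [caputoPrimitive, caputoPrimitive, if_neg h.ne, if_neg h.ne, ← h1.2, ← h2.2,
      intervalIntegral.integral_interval_sub_left h1.1 h2.1]

/-! ### Fourier coefficients and the action of `A(D)` on them. -/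

lemma cell_ae_eq_Icc (N : ℕ) :
    (cell N : Set (Fin N → ℝ)) =ᵐ[volume] Icc (fun _ => -Real.pi) (fun _ => Real.pi) := by
  rw [volume_pi]
  exact Measure.univ_pi_Ioc_ae_eq_Icc

lemma cell_subset_Icc (N : ℕ) : cell N ⊆ Icc (fun _ => -Real.pi) (fun _ => Real.pi) := by
  intro x hx
  exact ⟨fun i => (hx i trivial).1.le, fun i => (hx i trivial).2⟩

lemma measurableSet_cell (N : ℕ) : MeasurableSet (cell N) :=
  MeasurableSet.univ_pi fun _ => measurableSet_Ioc

lemma integrableOn_cell {N : ℕ} {g : (Fin N → ℝ) → ℂ} (hg : Continuous g) :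
    IntegrableOn g (cell N) :=
  (hg.continuousOn.integrableOn_compact isCompact_Icc).mono_set (cell_subset_Icc N)

/-- Divergence theorem on the cube for the field `h e_j`: by periodicity the two faces orthogonal to
`e_j` cancel. -/
lemma integral_lineDeriv_eq_zero {N : ℕ} {h : (Fin N → ℝ) → ℂ} (hh : ContDiff ℝ 1 h)
    (hp : TorusPeriodic h) (j : Fin N) :
    ∫ x in cell N, lineDeriv ℝ h x (Pi.single j 1) = 0 := by
  cases N with
  | zero => exact j.elim0
  | succ n =>
    rw [setIntegral_congr_set (cell_ae_eq_Icc (n + 1))]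
    have hd : Differentiable ℝ h := hh.differentiable one_ne_zero
    have key := integral_divergence_of_hasFDerivAt_off_countable' (n := n)
      (fun _ => -Real.pi) (fun _ => Real.pi) (fun _ => by linarith [Real.pi_pos])
      (fun i => if i = j then h else 0) (fun i x => if i = j then fderiv ℝ h x else 0) ∅
      countable_empty
      (fun i => by
        split_ifs
        · exact hh.continuous.continuousOn
        · exact continuousOn_const)
      (fun x _ i => by
        split_ifs
        · exact (hd x).hasFDerivAt
        · exact hasFDerivAt_const 0 x)
    have e : ∀ x, ∑ i, (if i = j then fderiv ℝ h x else 0) (Pi.single i 1)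
        = fderiv ℝ h x (Pi.single j 1) := by
      intro x
      rw [Finset.sum_eq_single j]
      · simp
      · intro i _ hij; simp [hij]
      · simp
    have hc : Continuous fun x => fderiv ℝ h x (Pi.single j 1) :=
      (hh.continuous_fderiv one_ne_zero).clm_apply continuous_const
    simp_rw [e] at key
    have key := key (hc.continuousOn.integrableOn_compact isCompact_Icc)
    have e2 : ∀ x, lineDeriv ℝ h x (Pi.single j 1) = fderiv ℝ h x (Pi.single j 1) :=
      fun x => (hd x).lineDeriv_eq_fderiv
    simp_rw [e2]
    rw [key]
    refine Finset.sum_eq_zero fun i _ => ?_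
    by_cases hij : i = j
    · subst hij
      rw [sub_eq_zero]
      congr 1
      ext x
      simp only [if_true]
      have : (i.insertNth Real.pi x : Fin (n + 1) → ℝ)
          = i.insertNth (-Real.pi) x + Pi.single i (2 * Real.pi) := by
        ext k
        refine Fin.succAboveCases i ?_ (fun k => ?_) k
        · simp; ring
        · simp
      rw [this]
      exact hp i _
    · simp [hij]

/-- The character `x ↦ e^{-inx}` of the torus. -/
def character {N : ℕ} (n : Fin N → ℤ) (x : Fin N → ℝ) : ℂ :=
  Complex.exp (-Complex.I * ∑ j, (n j : ℂ) * (x j : ℂ))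

/-- The (unnormalized) Fourier coefficient of a function on the torus. -/
def fcoef {N : ℕ} (n : Fin N → ℤ) (g : (Fin N → ℝ) → ℂ) : ℂ :=
  ∫ x in cell N, g x * character n x

lemma contDiff_character {N : ℕ} (n : Fin N → ℤ) {k : WithTop ℕ∞} : ContDiff ℝ k (character n) := by
  unfold character
  apply ContDiff.cexp
  refine contDiff_const.mul (ContDiff.sum fun j _ => contDiff_const.mul ?_)
  exact Complex.ofRealCLM.contDiff.comp (contDiff_apply ℝ ℝ j)

lemma continuous_character {N : ℕ} (n : Fin N → ℤ) : Continuous (character n) :=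
  (contDiff_character n (k := 0)).continuous

lemma periodic_character {N : ℕ} (n : Fin N → ℤ) : TorusPeriodic (character n) := by
  intro j x
  have : ∑ i, (n i : ℂ) * (((x + Pi.single j (2 * Real.pi) : Fin N → ℝ) i : ℝ) : ℂ)
      = ∑ i, (n i : ℂ) * (x i : ℂ) + n j * (2 * Real.pi) := by
    simp only [Pi.add_apply, Complex.ofReal_add, mul_add, Finset.sum_add_distrib]
    congr 1
    rw [Finset.sum_eq_single j]
    · simp
    · intro i _ hij; simp [hij]
    · simp
  unfold character
  rw [this, mul_add, Complex.exp_add]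
  have h2 : Complex.exp (-Complex.I * (n j * (2 * Real.pi))) = 1 := by
    rw [Complex.exp_eq_one_iff]
    exact ⟨-n j, by push_cast; ring⟩
  rw [h2, mul_one]

lemma hasLineDerivAt_character {N : ℕ} (n : Fin N → ℤ) (x : Fin N → ℝ) (j : Fin N) :
    HasLineDerivAt ℝ (character n) (-Complex.I * n j * character n x) x (Pi.single j 1) := by
  unfold HasLineDerivAt
  have e : ∀ t : ℝ, character n (x + t • Pi.single j 1)
      = character n x * Complex.exp ((-Complex.I * n j) * (t : ℂ)) := by
    intro t
    unfold character
    rw [← Complex.exp_add]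
    congr 1
    have : ∑ i, (n i : ℂ) * (((x + t • Pi.single j 1 : Fin N → ℝ) i : ℝ) : ℂ)
        = ∑ i, (n i : ℂ) * (x i : ℂ) + n j * t := by
      simp only [Pi.add_apply, Complex.ofReal_add, mul_add, Finset.sum_add_distrib]
      congr 1
      rw [Finset.sum_eq_single j]
      · simp
      · intro i _ hij; simp [hij]
      · simp
    rw [this]; ring
  simp_rw [e]
  have h1 : HasDerivAt (fun t : ℝ => (-Complex.I * n j) * (t : ℂ)) (-Complex.I * n j) 0 := by
    simpa using (Complex.ofRealCLM.hasDerivAt (x := (0 : ℝ))).const_mul (-Complex.I * n j)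
  have := (h1.cexp).const_mul (character n x)
  have h2 : character n x * (Complex.exp (-Complex.I * n j * ((0 : ℝ) : ℂ)) * (-Complex.I * n j))
      = -Complex.I * n j * character n x := by
    simp [mul_comm]
  rwa [h2] at this

lemma TorusPeriodic.mul {N : ℕ} {g h : (Fin N → ℝ) → ℂ} (hg : TorusPeriodic g)
    (hh : TorusPeriodic h) : TorusPeriodic (fun x => g x * h x) :=
  fun j x => by simp only [hg j x, hh j x]

lemma TorusPeriodic.dOp {N : ℕ} {g : (Fin N → ℝ) → ℂ} (hg : TorusPeriodic g) (j : Fin N) :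
    TorusPeriodic (dOp j g) := by
  intro i x
  unfold Subdiffusion.dOp lineDeriv
  congr 2
  ext t
  rw [add_right_comm]
  exact hg i _

lemma contDiff_dOp {N : ℕ} {g : (Fin N → ℝ) → ℂ} {k : ℕ} (hg : ContDiff ℝ (k + 1 : ℕ) g)
    (j : Fin N) : ContDiff ℝ k (dOp j g) := by
  have hd : Differentiable ℝ g := hg.differentiable (by simp)
  have : dOp j g = fun x => -Complex.I * fderiv ℝ g x (Pi.single j 1) := by
    ext x
    rw [dOp, (hd x).lineDeriv_eq_fderiv]
  rw [this]
  refine contDiff_const.mul (ContDiff.clm_apply ?_ contDiff_const)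
  exact hg.fderiv_right (by push_cast; exact le_rfl)

/-- Integration by parts: the derivative of `g` times the character has integral zero. -/
lemma fcoef_dOp {N : ℕ} {g : (Fin N → ℝ) → ℂ} (hg : ContDiff ℝ 1 g) (hp : TorusPeriodic g)
    (n : Fin N → ℤ) (j : Fin N) : fcoef n (dOp j g) = n j * fcoef n g := by
  have hd : Differentiable ℝ g := hg.differentiable one_ne_zero
  have h0 := integral_lineDeriv_eq_zero (hg.mul (contDiff_character n)) (hp.mul (periodic_character n)) j
  have e : ∀ x, lineDeriv ℝ (fun x => g x * character n x) x (Pi.single j 1)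
      = Complex.I * (dOp j g x * character n x) - Complex.I * n j * (g x * character n x) := by
    intro x
    have h1 := (hd x).lineDifferentiableAt (v := Pi.single j 1) |>.hasLineDerivAt
    have h2 := HasDerivAt.mul h1 (hasLineDerivAt_character n x j)
    have h3 : HasLineDerivAt ℝ (fun x => g x * character n x) _ x (Pi.single j 1) := h2
    rw [h3.lineDeriv]
    simp only [zero_smul, add_zero, dOp]
    linear_combination (lineDeriv ℝ g x (Pi.single j 1) * character n x) * Complex.I_mul_I
  simp_rw [e] at h0
  have hc1 : Continuous (fun x => dOp j g x * character n x) :=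
    (contDiff_dOp (k := 0) (by simpa using hg) j).continuous.mul (continuous_character n)
  have hc2 : Continuous (fun x => g x * character n x) :=
    hg.continuous.mul (continuous_character n)
  rw [integral_sub ((integrableOn_cell hc1).const_mul _) ((integrableOn_cell hc2).const_mul _),
    integral_const_mul, integral_const_mul, mul_assoc, ← mul_sub] at h0
  exact sub_eq_zero.1 ((mul_eq_zero.1 h0).resolve_left Complex.I_ne_zero)

lemma dOp_iterate {N : ℕ} (n : Fin N → ℤ) (j : Fin N) (r k : ℕ) {g : (Fin N → ℝ) → ℂ}
    (hg : ContDiff ℝ (k + r : ℕ) g) (hp : TorusPeriodic g) :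
    ContDiff ℝ k ((dOp j)^[r] g) ∧ TorusPeriodic ((dOp j)^[r] g) ∧
      fcoef n ((dOp j)^[r] g) = (n j : ℂ) ^ r * fcoef n g := by
  induction r generalizing g with
  | zero => exact ⟨by simpa using hg, by simpa using hp, by simp⟩
  | succ r ih =>
    obtain ⟨h1, h2, h3⟩ := ih (contDiff_dOp (k := k + r) hg j) (hp.dOp j)
    rw [Function.iterate_succ_apply]
    refine ⟨h1, h2, ?_⟩
    rw [h3, fcoef_dOp (hg.of_le (by norm_cast; omega)) hp, pow_succ, mul_assoc]

/-- Derivatives are counted exactly, so that `C^m` regularity suffices for an operator of order `m`;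
`k` is the smoothness left over. -/
lemma foldr_dOp {N : ℕ} (n : Fin N → ℤ) (α : Fin N → ℕ) (l : List (Fin N)) (k : ℕ)
    {g : (Fin N → ℝ) → ℂ} (hg : ContDiff ℝ (k + (l.map α).sum : ℕ) g) (hp : TorusPeriodic g) :
    ContDiff ℝ k (l.foldr (fun j h => (dOp j)^[α j] h) g) ∧
      TorusPeriodic (l.foldr (fun j h => (dOp j)^[α j] h) g) ∧
      fcoef n (l.foldr (fun j h => (dOp j)^[α j] h) g)
        = (l.map fun j => (n j : ℂ) ^ α j).prod * fcoef n g := by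
  induction l generalizing k with
  | nil => exact ⟨by simpa using hg, by simpa using hp, by simp⟩
  | cons j l ih =>
    obtain ⟨h1, h2, h3⟩ := ih (k + α j) (by simpa [add_assoc] using hg)
    obtain ⟨h4, h5, h6⟩ := dOp_iterate n j (α j) k h1 h2
    simp only [List.foldr_cons, List.map_cons, List.prod_cons]
    refine ⟨h4, h5, ?_⟩
    rw [h6, h3, mul_assoc]

lemma fcoef_diffOp {N : ℕ} (n : Fin N → ℤ) (m : ℕ) (a : (Fin N → ℕ) → ℂ) {g : (Fin N → ℝ) → ℂ}
    (hg : ContDiff ℝ m g) (hp : TorusPeriodic g) :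
    fcoef n (diffOp m a g) = symbol m a (fun j => (n j : ℝ)) * fcoef n g := by
  have key : ∀ α ∈ multiIndices N m, Continuous (dPow α g) ∧
      fcoef n (dPow α g) = (∏ j, (n j : ℂ) ^ α j) * fcoef n g := by
    intro α hα
    have hs : ((List.finRange N).map α).sum = m := by
      rw [← Fin.sum_univ_def]
      exact (Finset.mem_piAntidiag.1 hα).1
    obtain ⟨h1, -, h3⟩ := foldr_dOp n α (List.finRange N) 0 (g := g) (by simpa [hs] using hg) hp
    refine ⟨h1.continuous, ?_⟩
    rw [Fin.prod_univ_def]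
    exact h3
  have hint : ∀ α ∈ multiIndices N m,
      IntegrableOn (fun x => a α * (dPow α g x * character n x)) (cell N) := fun α hα =>
    (integrableOn_cell ((key α hα).1.mul (continuous_character n))).const_mul _
  unfold fcoef diffOp symbol
  simp_rw [Finset.sum_mul, mul_assoc]
  rw [integral_finsetSum _ hint]
  refine Finset.sum_congr rfl fun α hα => ?_
  rw [integral_const_mul]
  have := (key α hα).2
  unfold fcoef at this
  rw [this]
  push_cast
  rfl

lemma conj_character {N : ℕ} (n : Fin N → ℤ) (x : Fin N → ℝ) :
    (starRingEnd ℂ) (character (-n) x) = character n x := by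
  unfold character
  rw [← Complex.exp_conj]
  congr 1
  simp [map_sum]

lemma torusInner_character {N : ℕ} (n : Fin N → ℤ) (g : (Fin N → ℝ) → ℂ) :
    torusInner g (character (-n)) = fcoef n g := by
  unfold torusInner fcoef
  simp_rw [conj_character]

lemma torusInner_conj {N : ℕ} (g h : (Fin N → ℝ) → ℂ) :
    torusInner g h = (starRingEnd ℂ) (torusInner h g) := by
  unfold torusInner
  rw [← integral_conj]
  congr 1; ext x
  simp [mul_comm]

lemma fcoef_character_self {N : ℕ} (n : Fin N → ℤ) :
    fcoef n (character (-n)) = (((2 * Real.pi) ^ N : ℝ) : ℂ) := by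
  unfold fcoef
  have : ∀ x, character (-n) x * character n x = 1 := by
    intro x
    unfold character
    rw [← Complex.exp_add, ← Complex.exp_zero]
    congr 1
    simp
  simp_rw [this]
  rw [setIntegral_const, Measure.real, cell, Real.volume_pi_Ioc_toReal (fun _ => by linarith [Real.pi_pos])]
  simp [two_mul]

/-- The symbol of a symmetric positive operator is real and nonnegative at integer points. -/
lemma symbol_eq_ofReal {N : ℕ} {m : ℕ} {a : (Fin N → ℕ) → ℂ} (hsymm : IsSymmetricOp m a)
    (hpos : IsPositiveOp m a) (n : Fin N → ℤ) :
    ∃ lam : ℝ, 0 ≤ lam ∧ symbol m a (fun j => (n j : ℝ)) = lam := by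
  have hc : ContDiff ℝ ∞ (character (-n)) := contDiff_character _
  have hp := periodic_character (-n)
  -- The test function is `e^{inx}`, for which `(A(D)g, g)` is the symbol at `n` times the volume of
  -- the cell.
  have e : torusInner (diffOp m a (character (-n))) (character (-n))
      = symbol m a (fun j => (n j : ℝ)) * (((2 * Real.pi) ^ N : ℝ) : ℂ) := by
    rw [torusInner_character, fcoef_diffOp n m a (contDiff_character _) hp, fcoef_character_self]
  have hpi : 0 < (2 * Real.pi) ^ N := by positivity
  have h1 := hsymm _ _ hc hp hc hp
  rw [torusInner_conj (character (-n)), e, map_mul, Complex.conj_ofReal] at h1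
  have h2 := mul_right_cancel₀ (Complex.ofReal_ne_zero.2 hpi.ne') h1
  have h3 := hpos _ hc hp
  rw [e, Complex.re_mul_ofReal] at h3
  exact ⟨_, nonneg_of_mul_nonneg_left h3 hpi, (Complex.conj_eq_iff_re.1 h2.symm).symm⟩

/-! ### Completeness of the characters. -/

lemma TorusPeriodic.periodic_sum {N : ℕ} {g : (Fin N → ℝ) → ℂ} (hp : TorusPeriodic g)
    (k : Fin N → ℤ) : Function.Periodic g (fun j => 2 * Real.pi * k j) := by
  have h : ∀ s : Finset (Fin N),
      Function.Periodic g (∑ j ∈ s, k j • (Pi.single j (2 * Real.pi) : Fin N → ℝ)) := by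
    intro s
    induction s using Finset.induction_on with
    | empty => intro x; simp
    | insert j s hj ih =>
      rw [Finset.sum_insert hj]
      exact ((hp j).zsmul (k j)).add_period ih
  convert h Finset.univ using 1
  ext i
  rw [Finset.sum_apply, Finset.sum_eq_single i]
  · simp [mul_comm]
  · intro j _ hj; simp [hj.symm]
  · simp

open scoped Pointwise in
lemma smul_centered_unit_cell (N : ℕ) :
    (2 * Real.pi) • {x : Fin N → ℝ | ∀ i, x i ∈ Ioc (-1 / 2 : ℝ) (-1 / 2 + 1)} = cell N := by
  have hpi := Real.pi_pos
  ext x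
  rw [Set.mem_smul_set_iff_inv_smul_mem₀ (by positivity)]
  simp only [mem_ofPred_eq, Pi.smul_apply, smul_eq_mul, cell, mem_univ_pi, mem_Ioc]
  refine forall_congr' fun i => and_congr ?_ ?_
  · rw [lt_inv_mul_iff₀ (by positivity), show 2 * Real.pi * (-1 / 2) = -Real.pi by ring]
  · rw [inv_mul_le_iff₀ (by positivity), show 2 * Real.pi * (-1 / 2 + 1) = Real.pi by ring]

/-- A continuous function on the torus is determined by its Fourier coefficients. -/
theorem eq_zero_of_fcoef_eq_zero {N : ℕ} {g : (Fin N → ℝ) → ℂ} (hg : Continuous g)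
    (hp : TorusPeriodic g) (h : ∀ n, fcoef n g = 0) (x : Fin N → ℝ) : g x = 0 := by
  have hpi := Real.pi_pos
  -- After rescaling by `2π`, `g` descends along the quotient map to a continuous function `G` on
  -- the unit torus.
  let q : C(Fin N → ℝ, UnitAddTorus (Fin N)) :=
    ⟨fun x i => (x i : UnitAddCircle), by fun_prop⟩
  have hq : IsQuotientMap q :=
    (IsOpenQuotientMap.piMap (fun _ : Fin N => QuotientAddGroup.isOpenQuotientMap_mk
      (N := AddSubgroup.zmultiples (1 : ℝ)))).isQuotientMap
  let g' : C(Fin N → ℝ, ℂ) := ⟨fun x => g ((2 * Real.pi) • x), by fun_prop⟩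
  have hfac : Function.FactorsThrough g' q := by
    intro a b hab
    have hk : ∀ i, ∃ k : ℤ, a i = b i + k := by
      intro i
      have h1 : (a i : UnitAddCircle) = b i := congrFun hab i
      have h2 : ((a i - b i : ℝ) : UnitAddCircle) = 0 := by
        rw [AddCircle.coe_sub, h1, sub_self]
      obtain ⟨k, hk⟩ := (AddCircle.coe_eq_zero_iff (1 : ℝ)).1 h2
      exact ⟨k, by simp at hk; linarith⟩
    choose k hk using hk
    have := hp.periodic_sum k ((2 * Real.pi) • b)
    change g ((2 * Real.pi) • a) = g ((2 * Real.pi) • b)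
    rw [← this]
    congr 1
    ext i
    simp [hk i, mul_add]
  let G : C(UnitAddTorus (Fin N), ℂ) := hq.lift g' hfac
  have hG : ∀ x : Fin N → ℝ, G (fun i => (x i : UnitAddCircle)) = g ((2 * Real.pi) • x) := fun x =>
    DFunLike.congr_fun (hq.lift_comp g' hfac) x
  have hcoef : UnitAddTorus.mFourierCoeff G = 0 := by
    ext n
    rw [UnitAddTorus.mFourierCoeff_eq_integral G n (fun _ => -1 / 2)]
    have e : ∀ x : Fin N → ℝ, UnitAddTorus.mFourier (-n) (fun i => (x i : UnitAddCircle))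
        • G (fun i => (x i : UnitAddCircle))
        = (fun y => g y * character n y) ((2 * Real.pi) • x) := by
      intro x
      rw [hG, smul_eq_mul, mul_comm]
      congr 1
      simp only [UnitAddTorus.mFourier, ContinuousMap.coe_mk, fourier_coe_apply, character]
      rw [← Complex.exp_sum, Finset.mul_sum]
      congr 1
      refine Finset.sum_congr rfl fun i _ => ?_
      simp
      ring
    simp_rw [e]
    rw [Measure.setIntegral_comp_smul_of_pos volume (fun y => g y * character n y) _ (by positivity : 0 < 2 * Real.pi),
      smul_centered_unit_cell]
    have := h n
    unfold fcoef at this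
    rw [this, smul_zero, Pi.zero_apply]
  -- Vanishing coefficients are trivially summable, so the Fourier series converges pointwise to
  -- `G`; its sum is `0`.
  have hs := UnitAddTorus.hasSum_mFourier_series_apply_of_summable (f := G)
    (by rw [hcoef]; exact summable_zero) (fun i => (((2 * Real.pi)⁻¹ • x) i : UnitAddCircle))
  rw [hcoef, hG, smul_inv_smul₀ (by positivity)] at hs
  simpa using hs.unique (by simp)

/-! ### Exchanging Fourier coefficients with integration in time. -/

/-- Clamping time to `[a, b]` gives a globally continuous function, the form in which the Fubini
lemmas are applied. -/
lemma continuous_comp_projIcc {X Y : Type*} [TopologicalSpace X] [TopologicalSpace Y] {a b : ℝ}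
    (hab : a ≤ b) {F : X → ℝ → Y}
    (hF : ContinuousOn (fun p : X × ℝ => F p.1 p.2) (univ ×ˢ Icc a b)) :
    Continuous fun p : X × ℝ => F p.1 (projIcc a b hab p.2) := by
  have hc : Continuous fun p : X × ℝ => (p.1, (projIcc a b hab p.2 : ℝ)) :=
    continuous_fst.prodMk (continuous_subtype_val.comp (continuous_projIcc.comp continuous_snd))
  exact hF.comp_continuous hc fun p => ⟨mem_univ _, (projIcc a b hab p.2).2⟩

lemma continuous_fcoef {N : ℕ} (n : Fin N → ℤ) {F : (Fin N → ℝ) → ℝ → ℂ}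
    (hF : Continuous fun p : (Fin N → ℝ) × ℝ => F p.1 p.2) :
    Continuous fun t => fcoef n (fun x => F x t) := by
  unfold fcoef
  simp_rw [setIntegral_congr_set (cell_ae_eq_Icc N)]
  refine continuous_parametric_integral_of_continuous (f := fun t x => F x t * character n x) ?_
    isCompact_Icc
  have h1 : Continuous fun p : ℝ × (Fin N → ℝ) => F p.2 p.1 := hF.comp continuous_swap
  exact h1.mul ((continuous_character n).comp continuous_snd)

/-- The weight `k` may be singular, like `(t - s)^(-ρ)`; `F` is bounded on the compact box. -/
lemma integrable_smul_prod_cell {N : ℕ} {F : (Fin N → ℝ) → ℝ → ℂ}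
    (hF : Continuous fun p : (Fin N → ℝ) × ℝ => F p.1 p.2) {k : ℝ → ℝ} {a b : ℝ}
    (hk : IntegrableOn k (Ioc a b)) :
    Integrable (Function.uncurry fun x s => k s • F x s)
      ((volume.restrict (cell N)).prod (volume.restrict (Ioc a b))) := by
  have : IsFiniteMeasure (volume.restrict (cell N)) :=
    ⟨by rw [Measure.restrict_apply_univ]
        exact (measure_mono (cell_subset_Icc N)).trans_lt isCompact_Icc.measure_lt_top⟩
  obtain ⟨M, hM⟩ := ((isCompact_Icc (a := fun _ : Fin N => -Real.pi)
    (b := fun _ => Real.pi)).prod (isCompact_Icc (a := a) (b := b))).exists_bound_of_continuousOn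
    hF.continuousOn
  refine (hk.comp_snd (volume.restrict (cell N))).smul_bdd M hF.aestronglyMeasurable ?_
  rw [Measure.prod_restrict]
  filter_upwards [ae_restrict_mem ((measurableSet_cell N).prod measurableSet_Ioc)] with p hp
  exact hM p ⟨cell_subset_Icc N hp.1, Ioc_subset_Icc_self hp.2⟩

/-- Fourier coefficients commute with weighted integration in time. -/
lemma fcoef_intervalIntegral {N : ℕ} (n : Fin N → ℤ) {F : (Fin N → ℝ) → ℝ → ℂ}
    (hF : Continuous fun p : (Fin N → ℝ) × ℝ => F p.1 p.2) {k : ℝ → ℝ} {a b : ℝ} (hab : a ≤ b)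
    (hk : IntervalIntegrable k volume a b) :
    IntegrableOn (fun x => (∫ s in a..b, k s • F x s) * character n x) (cell N) ∧
    fcoef n (fun x => ∫ s in a..b, k s • F x s) = ∫ s in a..b, k s • fcoef n (fun x => F x s) := by
  have hF' : Continuous fun p : (Fin N → ℝ) × ℝ => F p.1 p.2 * character n p.1 :=
    hF.mul ((continuous_character n).comp continuous_fst)
  have hi := integrable_smul_prod_cell (F := fun x s => F x s * character n x) hF'
    ((intervalIntegrable_iff_integrableOn_Ioc_of_le hab).1 hk)
  have e : ∀ x, (∫ s in a..b, k s • F x s) * character n x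
      = ∫ s in Ioc a b, k s • (F x s * character n x) := by
    intro x
    rw [intervalIntegral.integral_of_le hab, ← integral_mul_const]
    simp_rw [smul_mul_assoc]
  unfold fcoef
  simp_rw [e]
  refine ⟨hi.integral_prod_left, ?_⟩
  rw [integral_integral_swap hi, intervalIntegral.integral_of_le hab]
  simp_rw [integral_smul]

lemma caputoPrimitive_congr {ρ t : ℝ} (ht : 0 ≤ t) {g h : ℝ → ℂ} (hgh : ∀ s ∈ Icc 0 t, g s = h s) :
    caputoPrimitive ρ g t = caputoPrimitive ρ h t := by
  have h0 := hgh 0 ⟨le_rfl, ht⟩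
  unfold caputoPrimitive
  rw [hgh t ⟨ht, le_rfl⟩, h0]
  split_ifs
  · rfl
  · exact fracInt_congr ht fun s hs => by rw [hgh s hs]

/-- Stated under integrability, because continuity in `x` of `caputoPrimitive` is not established.
-/
lemma fcoef_sub {N : ℕ} (n : Fin N → ℤ) {g h : (Fin N → ℝ) → ℂ}
    (hg : IntegrableOn (fun x => g x * character n x) (cell N))
    (hh : IntegrableOn (fun x => h x * character n x) (cell N)) :
    fcoef n (fun x => g x - h x) = fcoef n g - fcoef n h := by
  unfold fcoef
  simp_rw [sub_mul]
  exact integral_sub hg hh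

lemma fcoef_sub_of_continuous {N : ℕ} (n : Fin N → ℤ) {g h : (Fin N → ℝ) → ℂ}
    (hg : Continuous g) (hh : Continuous h) :
    fcoef n (fun x => g x - h x) = fcoef n g - fcoef n h :=
  fcoef_sub n (integrableOn_cell (hg.mul (continuous_character n)))
    (integrableOn_cell (hh.mul (continuous_character n)))

lemma fcoef_caputoPrimitive {N : ℕ} (n : Fin N → ℤ) {F : (Fin N → ℝ) → ℝ → ℂ}
    (hF : Continuous fun p : (Fin N → ℝ) × ℝ => F p.1 p.2) {ρ t : ℝ} (hρ1 : ρ ≤ 1) (ht : 0 ≤ t) :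
    IntegrableOn (fun x => caputoPrimitive ρ (F x) t * character n x) (cell N) ∧
    fcoef n (fun x => caputoPrimitive ρ (F x) t)
      = caputoPrimitive ρ (fun s => fcoef n (fun x => F x s)) t := by
  have hFt : ∀ s, Continuous fun x => F x s := fun s =>
    hF.comp (continuous_id.prodMk continuous_const)
  have hF0 : Continuous fun p : (Fin N → ℝ) × ℝ => F p.1 p.2 - F p.1 0 :=
    hF.sub ((hFt 0).comp continuous_fst)
  unfold caputoPrimitive
  split_ifs with h
  · exact ⟨integrableOn_cell (((hFt t).sub (hFt 0)).mul (continuous_character n)),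
      fcoef_sub_of_continuous n (hFt t) (hFt 0)⟩
  · have h1 : 0 < 1 - ρ := sub_pos.2 (lt_of_le_of_ne hρ1 h)
    obtain ⟨i1, i2⟩ := fcoef_intervalIntegral n (F := fun x s => F x s - F x 0) hF0 ht
      (intervalIntegrable_rpow_sub h1 t)
    unfold fracInt
    constructor
    · simp_rw [smul_mul_assoc]
      exact i1.smul _
    · have : ∀ s, fcoef n (fun x => F x s) - fcoef n (fun x => F x 0)
          = fcoef n (fun x => F x s - F x 0) := fun s =>
        (fcoef_sub_of_continuous n (hFt s) (hFt 0)).symm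
      simp_rw [this]
      rw [← i2]
      unfold fcoef
      simp_rw [smul_mul_assoc]
      rw [integral_smul]

lemma tendsto_fracInt_zero {a : ℝ} (ha : 0 < a) {g : ℝ → ℂ} (hg : Continuous g) :
    Tendsto (fracInt a g) (𝓝[>] 0) (𝓝 0) := by
  obtain ⟨M, hM⟩ := (isCompact_Icc (a := (0 : ℝ)) (b := 1)).exists_bound_of_continuousOn
    hg.continuousOn
  have hlim : Tendsto (fun t : ℝ => t ^ a / Real.Gamma (a + 1) * M) (𝓝[>] 0) (𝓝 0) := by
    have : Tendsto (fun t : ℝ => t ^ a / Real.Gamma (a + 1) * M) (𝓝 0)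
        (𝓝 (0 ^ a / Real.Gamma (a + 1) * M)) :=
      ((Real.continuousAt_rpow_const 0 a (Or.inr ha.le)).tendsto.div_const _).mul_const _
    rw [Real.zero_rpow ha.ne', zero_div, zero_mul] at this
    exact this.mono_left nhdsWithin_le_nhds
  refine squeeze_zero_norm' ?_ hlim
  filter_upwards [Ioo_mem_nhdsGT one_pos] with t ht
  have hle : ‖∫ s in (0 : ℝ)..t, (t - s) ^ (a - 1) • g s‖ ≤ ∫ s in (0 : ℝ)..t, (t - s) ^ (a - 1) • M := by
    refine intervalIntegral.norm_integral_le_of_norm_le ht.1.le ?_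
      (intervalIntegrable_rpow_sub_smul ha continuous_const)
    refine Eventually.of_forall fun s hs => ?_
    rw [norm_smul, Real.norm_of_nonneg (Real.rpow_nonneg (by linarith [hs.2]) _), smul_eq_mul]
    exact mul_le_mul_of_nonneg_left (hM s ⟨hs.1.le, hs.2.trans ht.2.le⟩)
      (Real.rpow_nonneg (by linarith [hs.2]) _)
  have hΓ : 0 < (Real.Gamma a)⁻¹ := inv_pos.2 (Real.Gamma_pos_of_pos ha)
  have := fracInt_const (t := t) ha M
  rw [smul_eq_mul] at this
  rw [← this]
  unfold fracInt
  rw [norm_smul, Real.norm_of_nonneg hΓ.le, smul_eq_mul]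
  exact mul_le_mul_of_nonneg_left hle hΓ.le

lemma tendsto_caputoPrimitive_zero {ρ : ℝ} (hρ1 : ρ ≤ 1) {g : ℝ → ℂ} (hg : Continuous g) :
    Tendsto (caputoPrimitive ρ g) (𝓝[>] 0) (𝓝 0) := by
  unfold caputoPrimitive
  split_ifs with h
  · have : Tendsto (fun t => g t - g 0) (𝓝 0) (𝓝 (g 0 - g 0)) :=
      (hg.tendsto 0).sub_const _
    rw [sub_self] at this
    exact this.mono_left nhdsWithin_le_nhds
  · exact tendsto_fracInt_zero (sub_pos.2 (lt_of_le_of_ne hρ1 h)) (by fun_prop)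

/-! ### The integrated equation for the Fourier coefficients of a solution. -/

/-- The Fourier coefficient of a solution as a function of time, extended to `ℝ` by constants. -/
def timeCoef {N : ℕ} (n : Fin N → ℤ) {T : ℝ} (hT : 0 < T) (u : (Fin N → ℝ) → ℝ → ℂ) (t : ℝ) : ℂ :=
  fcoef n (fun x => u x (projIcc 0 T hT.le t))

lemma timeCoef_of_mem {N : ℕ} (n : Fin N → ℤ) {T : ℝ} (hT : 0 < T) (u : (Fin N → ℝ) → ℝ → ℂ) {t : ℝ}
    (ht : t ∈ Icc 0 T) : timeCoef n hT u t = fcoef n (fun x => u x t) := by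
  unfold timeCoef
  rw [projIcc_of_mem hT.le ht]

namespace IsClassicalSolution

variable {N m : ℕ} {a : (Fin N → ℕ) → ℂ} {ρ T : ℝ} {φ Ψ : (Fin N → ℝ) → ℂ}
  {u : (Fin N → ℝ) → ℝ → ℂ} {f : (Fin N → ℝ) → ℂ}

lemma continuous_timeCoef (h : IsClassicalSolution m a ρ T φ Ψ u f) (hT : 0 < T) (n : Fin N → ℤ) :
    Continuous (timeCoef n hT u) :=
  continuous_fcoef n (F := fun x t => u x (projIcc 0 T hT.le t))
    (continuous_comp_projIcc hT.le h.u_continuous)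

lemma continuous_space (h : IsClassicalSolution m a ρ T φ Ψ u f) {t : ℝ} (ht : t ∈ Icc 0 T) :
    Continuous fun x => u x t :=
  h.u_continuous.comp_continuous (f := fun x => (x, t)) (by fun_prop) fun _ => ⟨mem_univ _, ht⟩

lemma fcoef_caputoDeriv (h : IsClassicalSolution m a ρ T φ Ψ u f) (n : Fin N → ℤ) {t : ℝ}
    (ht : t ∈ Ioc 0 T) :
    fcoef n (fun x => caputoDeriv ρ T (u x) t)
      = fcoef n f - symbol m a (fun j => (n j : ℝ)) * fcoef n (fun x => u x t) := by
  have hc : Continuous fun x => diffOp m a (fun y => u y t) x :=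
    h.diffOp_continuous.comp_continuous (f := fun x => (x, t)) (by fun_prop)
      fun _ => ⟨mem_univ _, ht⟩
  have e : (fun x => caputoDeriv ρ T (u x) t) = fun x => f x - diffOp m a (fun y => u y t) x := by
    ext x
    rw [← h.equation x t ht, add_sub_cancel_right]
  rw [e, fcoef_sub_of_continuous n h.f_continuous hc,
    ← fcoef_diffOp n m a (h.u_contDiff t ht) (h.u_periodic t (Ioc_subset_Icc_self ht))]

/-- The fundamental theorem is applied to `u x` for each fixed `x`, where absolute continuity or
differentiability is known; only then is the Fourier coefficient taken. -/
lemma caputoPrimitive_timeCoef_sub (h : IsClassicalSolution m a ρ T φ Ψ u f) (hρ1 : ρ ≤ 1)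
    (hT : 0 < T) (n : Fin N → ℤ) {ε t : ℝ} (hε : 0 < ε) (hεt : ε ≤ t) (htT : t ≤ T) :
    caputoPrimitive ρ (timeCoef n hT u) t - caputoPrimitive ρ (timeCoef n hT u) ε
      = ∫ s in ε..t, (fcoef n f - symbol m a (fun j => (n j : ℝ)) * timeCoef n hT u s) := by
  have hF := continuous_comp_projIcc hT.le h.u_continuous
  have hsub : Icc ε t ⊆ Ioc 0 T := fun s hs => ⟨hε.trans_le hs.1, hs.2.trans htT⟩
  have hw : Continuous fun p : (Fin N → ℝ) × ℝ =>
      caputoDeriv ρ T (u p.1) (projIcc ε t hεt p.2) :=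
    continuous_comp_projIcc (F := fun x s => caputoDeriv ρ T (u x) s) hεt
      (h.caputo_continuous.mono (prod_mono_right hsub))
  obtain ⟨i1, e1⟩ := fcoef_caputoPrimitive n (F := fun x t => u x (projIcc 0 T hT.le t)) hF hρ1
    (hε.le.trans hεt)
  obtain ⟨i2, e2⟩ := fcoef_caputoPrimitive n (F := fun x t => u x (projIcc 0 T hT.le t)) hF hρ1
    hε.le
  unfold timeCoef
  rw [← e1, ← e2, ← fcoef_sub n i1 i2]
  have ext_eq : ∀ x, ∀ r ∈ Icc ε t, caputoPrimitive ρ (fun t => u x (projIcc 0 T hT.le t)) r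
      = caputoPrimitive ρ (u x) r := by
    intro x r hr
    refine caputoPrimitive_congr (hsub hr).1.le fun s hs => ?_
    rw [projIcc_of_mem hT.le ⟨hs.1, hs.2.trans (hsub hr).2⟩]
  have e3 : (fun x => caputoPrimitive ρ (fun t => u x (projIcc 0 T hT.le t)) t
      - caputoPrimitive ρ (fun t => u x (projIcc 0 T hT.le t)) ε)
      = fun x => ∫ s in ε..t, (1 : ℝ) • caputoDeriv ρ T (u x) (projIcc ε t hεt s) := by
    ext x
    rw [ext_eq x t ⟨hεt, le_rfl⟩, ext_eq x ε ⟨le_rfl, hεt⟩,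
      ← caputoPrimitive_sub hρ1 hε hεt htT (h.caputo_exists x)
        (h.caputo_continuous.comp (f := fun s => (x, s)) (by fun_prop)
          fun s hs => ⟨mem_univ _, hs⟩)]
    refine intervalIntegral.integral_congr fun s hs => ?_
    rw [uIcc_of_le hεt] at hs
    simp only [one_smul]
    rw [projIcc_of_mem hεt hs]
  rw [e3, (fcoef_intervalIntegral n hw hεt intervalIntegrable_const).2]
  refine intervalIntegral.integral_congr fun s hs => ?_
  rw [uIcc_of_le hεt] at hs
  simp only [one_smul]
  rw [projIcc_of_mem hεt hs, projIcc_of_mem hT.le (Ioc_subset_Icc_self (hsub hs))]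
  exact h.fcoef_caputoDeriv n (hsub hs)

/-- The Fourier coefficients of a solution satisfy the integrated relaxation equation. -/
theorem caputoPrimitive_timeCoef (h : IsClassicalSolution m a ρ T φ Ψ u f) (hρ1 : ρ ≤ 1)
    (hT : 0 < T) (n : Fin N → ℤ) {t : ℝ} (ht : t ∈ Icc 0 T) :
    caputoPrimitive ρ (timeCoef n hT u) t
      = ∫ s in (0 : ℝ)..t, (fcoef n f - symbol m a (fun j => (n j : ℝ)) * timeCoef n hT u s) := by
  have hY := h.continuous_timeCoef hT n
  rcases ht.1.eq_or_lt with h0 | h0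
  · subst h0
    simp [caputoPrimitive, fracInt]
  · have hG : Continuous fun s => fcoef n f - symbol m a (fun j => (n j : ℝ)) * timeCoef n hT u s := by
      fun_prop
    -- Let `ε → 0`: the primitive vanishes at `0+` and the right-hand integrand is continuous up to
    -- `0`.
    have l1 : Tendsto (fun ε => caputoPrimitive ρ (timeCoef n hT u) t
        - caputoPrimitive ρ (timeCoef n hT u) ε) (𝓝[>] 0)
        (𝓝 (caputoPrimitive ρ (timeCoef n hT u) t)) := by
      simpa using (tendsto_caputoPrimitive_zero hρ1 hY).const_sub
        (caputoPrimitive ρ (timeCoef n hT u) t)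
    have l2 : Tendsto (fun ε => ∫ s in ε..t,
        (fcoef n f - symbol m a (fun j => (n j : ℝ)) * timeCoef n hT u s)) (𝓝[>] 0)
        (𝓝 (∫ s in (0 : ℝ)..t,
          (fcoef n f - symbol m a (fun j => (n j : ℝ)) * timeCoef n hT u s))) := by
      simp_rw [fun ε => intervalIntegral.integral_symm (μ := volume) (f := fun s => fcoef n f
        - symbol m a (fun j => (n j : ℝ)) * timeCoef n hT u s) t ε]
      exact ((intervalIntegral.continuous_primitive (fun _ _ => hG.intervalIntegrable _ _)
        t).neg.tendsto 0).mono_left nhdsWithin_le_nhds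
    refine tendsto_nhds_unique l1 (l2.congr' ?_)
    filter_upwards [Ioo_mem_nhdsGT h0] with ε hε
    exact (h.caputoPrimitive_timeCoef_sub hρ1 hT n hε.1 hε.2.le ht.2).symm

end IsClassicalSolution

/-! ### Complex coefficients and the conclusion. -/

lemma fracInt_re {b : ℝ} (hb : 0 < b) {g : ℝ → ℂ} (hg : Continuous g) (t : ℝ) :
    fracInt b (fun s => (g s).re) t = (fracInt b g t).re := by
  unfold fracInt
  have := Complex.reCLM.intervalIntegral_comp_comm (intervalIntegrable_rpow_sub_smul (t := t) hb hg)
  simp only [Complex.reCLM_apply, Complex.smul_re] at this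
  rw [this, Complex.smul_re]

/-- The complex form of the uniqueness statement for the relaxation equation. -/
lemma eq_zero_of_caputoPrimitive {ρ T lam : ℝ} (hρ : 0 < ρ) (hρ1 : ρ ≤ 1) (hT : 0 < T)
    (hlam : 0 ≤ lam) {c : ℂ} {y : ℝ → ℂ} (hy : Continuous y) (hy0 : y 0 = 0) (hyT : y T = 0)
    (h : ∀ t ∈ Icc 0 T, caputoPrimitive ρ y t = ∫ s in (0 : ℝ)..t, (c - lam * y s)) :
    c = 0 ∧ ∀ t ∈ Icc 0 T, y t = 0 := by
  have real_part : ∀ (c : ℂ) (y : ℝ → ℂ), Continuous y → y 0 = 0 → y T = 0 →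
      (∀ t ∈ Icc 0 T, caputoPrimitive ρ y t = ∫ s in (0 : ℝ)..t, (c - lam * y s)) →
      c.re = 0 ∧ ∀ t ∈ Icc 0 T, (y t).re = 0 := by
    intro c y hy hy0 hyT h
    have hre : ∀ t, ∫ s in (0 : ℝ)..t, (c.re - lam * (y s).re)
        = (∫ s in (0 : ℝ)..t, (c - lam * y s)).re := by
      intro t
      have := Complex.reCLM.intervalIntegral_comp_comm (μ := volume) (a := 0) (b := t)
        (f := fun s => c - lam * y s) (Continuous.intervalIntegrable (by fun_prop) _ _)
      simpa using this
    have hyr : Continuous fun s => (y s).re := Complex.continuous_re.comp hy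
    rcases hρ1.eq_or_lt with h1 | h1
    · refine eq_zero_of_integrated_ode hT hlam hyr (by simp [hyT]) fun t ht => ?_
      rw [hre, ← h t ht, caputoPrimitive, if_pos h1, hy0, sub_zero]
    · refine IntegratedRelaxation.eq_zero hT hρ h1 hlam hyr (by simp [hy0]) (by simp [hyT])
        fun t ht => ?_
      rw [hre, ← h t ht, caputoPrimitive, if_neg h1.ne, fracInt_re (sub_pos.2 h1) hy]
      simp [hy0]
  -- Multiplication by `i` turns imaginary parts into real parts up to sign, so the real case
  -- applies again; `lam` being real keeps the equation intact.
  have hrot : ∀ t ∈ Icc 0 T, caputoPrimitive ρ (fun s => Complex.I * y s) t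
      = ∫ s in (0 : ℝ)..t, (Complex.I * c - lam * (Complex.I * y s)) := by
    intro t ht
    have e1 : caputoPrimitive ρ (fun s => Complex.I * y s) t = Complex.I * caputoPrimitive ρ y t := by
      unfold caputoPrimitive
      split_ifs
      · ring
      · have := fracInt_const_smul (1 - ρ) t Complex.I (fun s => y s - y 0)
        simp only [smul_eq_mul, mul_sub] at this
        exact this
    rw [e1, h t ht, ← intervalIntegral.integral_const_mul]
    congr 1; ext s; ring
  obtain ⟨c1, y1⟩ := real_part c y hy hy0 hyT h
  obtain ⟨c2, y2⟩ := real_part (Complex.I * c) (fun s => Complex.I * y s) (by fun_prop)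
    (by simp [hy0]) (by simp [hyT]) hrot
  refine ⟨Complex.ext c1 (by simpa using c2), fun t ht => Complex.ext (y1 t ht) ?_⟩
  simpa using y2 t ht

lemma caputoPrimitive_sub_of_continuous {ρ : ℝ} (hρ1 : ρ ≤ 1) {g h : ℝ → ℂ} (hg : Continuous g)
    (hh : Continuous h) (t : ℝ) :
    caputoPrimitive ρ (fun s => g s - h s) t = caputoPrimitive ρ g t - caputoPrimitive ρ h t := by
  unfold caputoPrimitive
  split_ifs with h1
  · ring
  · rw [← fracInt_sub_of_continuous (sub_pos.2 (lt_of_le_of_ne hρ1 h1)) t (by fun_prop) (by fun_prop)]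
    congr 1; ext s; ring

end Subdiffusion

end

open Subdiffusion in
theorem theorem3p1 {N : ℕ} (hN : 1 ≤ N) (m : ℕ) (a : (Fin N → ℕ) → ℂ)
    (hell : Subdiffusion.IsElliptic m a)
    (hsymm : Subdiffusion.IsSymmetricOp m a)
    (hpos : Subdiffusion.IsPositiveOp m a)
    (ρ T : ℝ) (hρ : 0 < ρ) (hρ' : ρ ≤ 1) (hT : 0 < T)
    (φ Ψ : (Fin N → ℝ) → ℂ)
    (hφ : Continuous φ) (hφp : Subdiffusion.TorusPeriodic φ)
    (hΨ : Continuous Ψ) (hΨp : Subdiffusion.TorusPeriodic Ψ)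
    (u₁ u₂ : (Fin N → ℝ) → ℝ → ℂ) (f₁ f₂ : (Fin N → ℝ) → ℂ)
    (h₁ : Subdiffusion.IsClassicalSolution m a ρ T φ Ψ u₁ f₁)
    (h₂ : Subdiffusion.IsClassicalSolution m a ρ T φ Ψ u₂ f₂) :
    (∀ x, ∀ t ∈ Set.Icc 0 T, u₁ x t = u₂ x t) ∧ f₁ = f₂ := by
  have h0 : (0 : ℝ) ∈ Icc 0 T := ⟨le_rfl, hT.le⟩
  have hTT : T ∈ Icc 0 T := ⟨hT.le, le_rfl⟩
  -- By linearity the differences of coefficients solve the relaxation problem with zero values at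
  -- both ends.
  have key : ∀ n : Fin N → ℤ, fcoef n f₁ - fcoef n f₂ = 0 ∧
      ∀ t ∈ Icc 0 T, timeCoef n hT u₁ t - timeCoef n hT u₂ t = 0 := by
    intro n
    obtain ⟨lam, hlam, hs⟩ := symbol_eq_ofReal hsymm hpos n
    have c1 := h₁.continuous_timeCoef hT n
    have c2 := h₂.continuous_timeCoef hT n
    refine eq_zero_of_caputoPrimitive (y := fun t => timeCoef n hT u₁ t - timeCoef n hT u₂ t)
      hρ hρ' hT hlam (c1.sub c2) ?_ ?_ fun t ht => ?_
    · simp only [timeCoef_of_mem n hT _ h0, h₁.initial, h₂.initial, sub_self]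
    · simp only [timeCoef_of_mem n hT _ hTT, h₁.final, h₂.final, sub_self]
    · rw [caputoPrimitive_sub_of_continuous hρ' c1 c2, h₁.caputoPrimitive_timeCoef hρ' hT n ht,
        h₂.caputoPrimitive_timeCoef hρ' hT n ht, hs,
        ← intervalIntegral.integral_sub (Continuous.intervalIntegrable (by fun_prop) _ _)
          (Continuous.intervalIntegrable (by fun_prop) _ _)]
      congr 1; ext s; ring
  constructor
  · intro x t ht
    have g1 := h₁.continuous_space ht
    have g2 := h₂.continuous_space ht
    refine sub_eq_zero.1 (eq_zero_of_fcoef_eq_zero (g := fun x => u₁ x t - u₂ x t) (g1.sub g2)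
      (fun j x => ?_) (fun n => ?_) x)
    · simp only [h₁.u_periodic t ht j x, h₂.u_periodic t ht j x]
    · rw [fcoef_sub_of_continuous n g1 g2, ← timeCoef_of_mem n hT u₁ ht,
        ← timeCoef_of_mem n hT u₂ ht]
      exact (key n).2 t ht
  · ext x
    refine sub_eq_zero.1 (eq_zero_of_fcoef_eq_zero (g := fun x => f₁ x - f₂ x)
      (h₁.f_continuous.sub h₂.f_continuous) (fun j x => ?_) (fun n => ?_) x)
    · simp only [h₁.f_periodic j x, h₂.f_periodic j x]
    · rw [fcoef_sub_of_continuous n h₁.f_continuous h₂.f_continuous]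
      exact (key n).1
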